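/- **Theorem.** Let $(M,g)$ be a smooth Lorentzian manifold of dimension $n=d+1\ge 1$ and signature $(-,+,\dots,+)$, with Levi-Civita connection $\nabla$. *Definitions.* For an open set $U\subseteq M$, a *torse-forming time-like unit vector field on $U$* is a smooth vector field $u$ on $U$ with $g(u,u)=-1$ for which there is a smooth function $\varphi:U\to\mathbb R$ such that, in all smooth charts, $$\nabla_i u_j=\varphi\,(u_iu_j+g_{ij})\qquad\text{on }U .$$ The open set $U$ is *a twisted product* if there are a non-empty open interval $I\subseteq\mathbb R$, a smooth $d$-dimensional Riemannian manifold $(M^*,g^*)$, a smooth function $f:I\times M^*\to(0,\infty)$, and a diffeomorphism $(t,x):U\to I\times M^*$ under which $$ds^2=-dt^2+f(t,x)^2\,g^*_{\mu\nu}(x)\,dx^\mu dx^\nu .$$ *Claim.* 1. (Local equivalence.) For every $p\in M$: $p$ has an open neighbourhood which is a twisted product if and only if $p$ has an open neighbourhood on which there is a torse-forming time-like unit vector field. In particular, $M$ is locally a twisted product if and only if it locally admits torse-forming time-like unit vector fields. 2. If $M$ admits a globally defined torse-forming time-like unit vector field, then every point of $M$ has an open neighbourhood which is a twisted product. 3.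 If $M$ as a whole is a twisted product, then $M$ admits a globally defined torse-forming time-like unit vector field. -/

import Mathlib

open Set
open scoped Manifold ContDiff Bundle

universe u w

noncomputable section

namespace TwistedLorentz

/-- The model space `ℝⁿ` of an `n`-dimensional manifold. -/
abbrev Model (n : ℕ) : Type := EuclideanSpace ℝ (Fin n)

/-- A smooth Lorentzian metric, of signature `(-, +, …, +)`, on a manifold of dimension `d + 1`:
a smooth field of symmetric bilinear forms on the tangent spaces, each of which has an
orthonormal basis with exactly one time-like member. -/
structure LorentzMetric (d : ℕ) (M : Type u) [TopologicalSpace M] [ChartedSpace (Model (d + 1)) M]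
    [IsManifold 𝓘(ℝ, Model (d + 1)) ∞ M] where
  /-- The bilinear form on each tangent space. -/
  val (p : M) : TangentSpace 𝓘(ℝ, Model (d + 1)) p →L[ℝ]
    TangentSpace 𝓘(ℝ, Model (d + 1)) p →L[ℝ] ℝ
  symm (p : M) (v w : TangentSpace 𝓘(ℝ, Model (d + 1)) p) : val p v w = val p w v
  signature (p : M) :
    ∃ b : Module.Basis (Fin (d + 1)) ℝ (TangentSpace 𝓘(ℝ, Model (d + 1)) p),
      ∀ i j, val p (b i) (b j) = if i = j then (if i = 0 then -1 else 1) else 0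
  contMDiff : ContMDiff 𝓘(ℝ, Model (d + 1))
    (𝓘(ℝ, Model (d + 1)).prod 𝓘(ℝ, Model (d + 1) →L[ℝ] Model (d + 1) →L[ℝ] ℝ)) ∞
    (fun p => Bundle.TotalSpace.mk' (Model (d + 1) →L[ℝ] Model (d + 1) →L[ℝ] ℝ)
      (E := fun p : M => TangentSpace 𝓘(ℝ, Model (d + 1)) p →L[ℝ]
        TangentSpace 𝓘(ℝ, Model (d + 1)) p →L[ℝ] ℝ) p (val p))

section Coordinates

variable {d : ℕ} {M : Type u} [TopologicalSpace M] [ChartedSpace (Model (d + 1)) M]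
  [IsManifold 𝓘(ℝ, Model (d + 1)) ∞ M]

/-- The partial derivative `∂ᵢ F` at `y` of a function on the coordinate space. -/
def partialDeriv (i : Fin (d + 1)) (F : Model (d + 1) → ℝ) (y : Model (d + 1)) : ℝ :=
  fderiv ℝ F y (EuclideanSpace.single i 1)

/-- The coordinate vector `∂ᵢ` of the chart `e`, at the point with coordinates `y`. -/
def coordVec (e : OpenPartialHomeomorph M (Model (d + 1))) (y : Model (d + 1))
    (i : Fin (d + 1)) : TangentSpace 𝓘(ℝ, Model (d + 1)) (e.symm y) :=
  mfderiv 𝓘(ℝ, Model (d + 1)) 𝓘(ℝ, Model (d + 1)) e.symm y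
    (EuclideanSpace.single i (1 : ℝ) : Model (d + 1))

/-- The matrix of components `g_{ij}` of the metric in the chart `e`. -/
def metricComp (g : LorentzMetric d M) (e : OpenPartialHomeomorph M (Model (d + 1)))
    (y : Model (d + 1)) : Matrix (Fin (d + 1)) (Fin (d + 1)) ℝ :=
  Matrix.of fun i j => g.val (e.symm y) (coordVec e y i) (coordVec e y j)

/-- The Christoffel symbols of the Levi-Civita connection in the chart `e`,
`Γᵏᵢⱼ = ½ gᵏᵐ (∂ᵢ g_{jm} + ∂ⱼ g_{im} - ∂ₘ g_{ij})`. -/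
def christoffel (g : LorentzMetric d M) (e : OpenPartialHomeomorph M (Model (d + 1)))
    (y : Model (d + 1)) (k i j : Fin (d + 1)) : ℝ :=
  (1 / 2) * ∑ m, (metricComp g e y)⁻¹ k m *
    (partialDeriv i (fun z => metricComp g e z j m) y
      + partialDeriv j (fun z => metricComp g e z i m) y
      - partialDeriv m (fun z => metricComp g e z i j) y)

/-- The covariant components `uⱼ = g(u, ∂ⱼ)` of a vector field in the chart `e`. -/
def lowerComp (g : LorentzMetric d M) (e : OpenPartialHomeomorph M (Model (d + 1)))
    (u : (p : M) → TangentSpace 𝓘(ℝ, Model (d + 1)) p) (y : Model (d + 1))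
    (j : Fin (d + 1)) : ℝ :=
  g.val (e.symm y) (u (e.symm y)) (coordVec e y j)

/-- The components `∇ᵢ uⱼ = ∂ᵢ uⱼ - Γᵏᵢⱼ uₖ` in the chart `e` of the Levi-Civita covariant
derivative of a vector field. -/
def covDeriv (g : LorentzMetric d M) (e : OpenPartialHomeomorph M (Model (d + 1)))
    (u : (p : M) → TangentSpace 𝓘(ℝ, Model (d + 1)) p) (y : Model (d + 1))
    (i j : Fin (d + 1)) : ℝ :=
  partialDeriv i (fun z => lowerComp g e u z j) y
    - ∑ k, christoffel g e y k i j * lowerComp g e u y k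

/-- `u` is a smooth time-like unit vector field on the open set `U` which is torse-forming:
there is a smooth scalar field `φ` with `∇ᵢ uⱼ = φ (uᵢ uⱼ + g_{ij})` on `U`. The tensor equation
is read in every chart of the maximal smooth atlas. The values of `u` outside `U` are
irrelevant. -/
def IsTorseFormingUnitTimelikeOn (g : LorentzMetric d M)
    (u : (p : M) → TangentSpace 𝓘(ℝ, Model (d + 1)) p) (U : Set M) : Prop :=
  ContMDiffOn 𝓘(ℝ, Model (d + 1)) 𝓘(ℝ, Model (d + 1)).tangent ∞
    (fun p => (⟨p, u p⟩ : TangentBundle 𝓘(ℝ, Model (d + 1)) M)) U ∧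
  (∀ p ∈ U, g.val p (u p) (u p) = -1) ∧
  ∃ φ : M → ℝ, ContMDiffOn 𝓘(ℝ, Model (d + 1)) 𝓘(ℝ, ℝ) ∞ φ U ∧
    ∀ e ∈ IsManifold.maximalAtlas 𝓘(ℝ, Model (d + 1)) ∞ M, ∀ p ∈ U ∩ e.source,
      ∀ i j : Fin (d + 1), covDeriv g e u (e p) i j =
        φ p * (lowerComp g e u (e p) i * lowerComp g e u (e p) j + metricComp g e (e p) i j)

end Coordinates

/-- The open set `U` with the metric `g` is isometric to a twisted product `I ×_f N`, where `I` is
an open interval, `N` is a `d`-dimensional Riemannian manifold with metric `gN`, and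
`f : I × N → (0, ∞)` is smooth: there is a diffeomorphism `e = (t, x)` of `U` onto `I × N` with
`g = -dt² + f(t, x)² gN(dx, dx)`. -/
def IsTwistedProductOn.{v, v'} {d : ℕ} {M : Type v'} [TopologicalSpace M]
    [ChartedSpace (Model (d + 1)) M] [IsManifold 𝓘(ℝ, Model (d + 1)) ∞ M]
    (g : LorentzMetric d M) (U : Set M) : Prop :=
  ∃ (J : Set ℝ) (N : Type v) (_ : TopologicalSpace N) (_ : ChartedSpace (Model d) N)
    (_ : IsManifold 𝓘(ℝ, Model d) ∞ N)
    (gN : Bundle.ContMDiffRiemannianMetric 𝓘(ℝ, Model d) ∞ (Model d)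
      (fun x : N => TangentSpace 𝓘(ℝ, Model d) x))
    (f : ℝ × N → ℝ) (e : OpenPartialHomeomorph M (ℝ × N)),
    (IsOpen J ∧ J.OrdConnected ∧ J.Nonempty) ∧
    ContMDiffOn (𝓘(ℝ, ℝ).prod 𝓘(ℝ, Model d)) 𝓘(ℝ, ℝ) ∞ f (J ×ˢ univ) ∧
    (∀ z ∈ J ×ˢ (univ : Set N), 0 < f z) ∧
    e.source = U ∧ e.target = J ×ˢ univ ∧
    ContMDiffOn 𝓘(ℝ, Model (d + 1)) (𝓘(ℝ, ℝ).prod 𝓘(ℝ, Model d)) ∞ e e.source ∧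
    ContMDiffOn (𝓘(ℝ, ℝ).prod 𝓘(ℝ, Model d)) 𝓘(ℝ, Model (d + 1)) ∞ e.symm e.target ∧
    ∀ p ∈ U, ∀ v w : TangentSpace 𝓘(ℝ, Model (d + 1)) p,
      let dt : TangentSpace 𝓘(ℝ, Model (d + 1)) p →L[ℝ] ℝ :=
        mfderiv 𝓘(ℝ, Model (d + 1)) 𝓘(ℝ, ℝ) (fun q => (e q).1) p
      let dx : TangentSpace 𝓘(ℝ, Model (d + 1)) p →L[ℝ] TangentSpace 𝓘(ℝ, Model d) (e p).2 :=
        mfderiv 𝓘(ℝ, Model (d + 1)) 𝓘(ℝ, Model d) (fun q => (e q).2) p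
      g.val p v w = -(dt v * dt w) + f (e p) ^ 2 * gN.inner (e p).2 (dx v) (dx w)


end TwistedLorentz

end

/-!
A torse-forming time-like unit field `u` with `∇ᵢ uⱼ = φ (uᵢ uⱼ + gᵢⱼ)` satisfies two first-order
identities, one for each symmetry type of `∇u♭`. The antisymmetric part says that `u♭` is closed;
the symmetric part says that the Lie derivative of the metric is `L_u g = 2 φ (u♭ ⊗ u♭ + g)`.
By the Poincaré lemma `u♭ = -dt` locally. Completing `t` by `d` first integrals `x` of `u` gives
coordinates `(t, x)` with `u = ∂ₜ`, in which `g = -dt² + h(t, x)(dx, dx)`, and the second identity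
becomes `∂ₜ h = 2 φ h`. The components of `h` along a time line are thus all multiplied by the same
positive factor: `h(t, x) = f(t, x)² h(0, x)`, which is a twisted product with `g* = h(0, ·)`.

Conversely, in a twisted product the field `∂ₜ` has `(∂ₜ)♭ = -dt`, which is closed, and
`L_{∂ₜ} g = 2 f ∂ₜf g* = 2 (∂ₜf / f) (dt² + g)`; the two identities together give back the
torse-forming equation with `φ = ∂ₜf / f`. This argument is global.

The computations take place on open subsets of vector spaces. There `∇u♭` is expressed by
`covDifferential`, in which the inverse metric no longer appears, and `covDeriv_eq_covDifferential`
identifies it with the expression through Christoffel symbols. Coordinates adapted to a field are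
constructed in `IsLocalTorseForming.exists_coordinates`, the twisted form of the metric in
`IsLocalTorseForming.exists_twisted_coordinates`, and the converse in `covDifferential_of_twisted`.

The first integrals come from the flow of the field (`exists_first_integrals`), which has to be
smooth jointly in time and the initial point. This is `exists_contDiffOn_flow`, an application of
the inverse function theorem in the Banach space of curves; it rests on the smoothness of the
superposition operator `γ ↦ f ∘ γ` (`contDiff_postcomp`).
-/

noncomputable section

namespace TwistedLorentz

/-! ### Superposition operators on spaces of continuous maps -/

section Superposition

variable {K : Type} [TopologicalSpace K] [CompactSpace K]
  {E F G : Type u} [NormedAddCommGroup E] [NormedSpace ℝ E] [NormedAddCommGroup F] [NormedSpace ℝ F]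
  [NormedAddCommGroup G] [NormedSpace ℝ G]

/-- Pointwise application of a bounded bilinear map to two continuous maps, as a bounded
bilinear map between spaces of continuous maps. -/
def pointwiseApply (B : G →L[ℝ] E →L[ℝ] F) : C(K, G) →L[ℝ] C(K, E) →L[ℝ] C(K, F) :=
  LinearMap.mkContinuous₂
    (LinearMap.mk₂ ℝ (fun (A : C(K, G)) (γ : C(K, E)) =>
        (⟨fun s => B (A s) (γ s), by fun_prop⟩ : C(K, F)))
      (fun _ _ _ => by ext; simp) (fun _ _ _ => by ext; simp)
      (fun _ _ _ => by ext; simp) (fun _ _ _ => by ext; simp)) ‖B‖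
    (fun A γ => by
      rw [ContinuousMap.norm_le _ (by positivity)]
      intro s
      exact (B.le_opNorm₂ _ _).trans (by
        gcongr
        exacts [A.norm_coe_le_norm s, γ.norm_coe_le_norm s]))

@[simp] lemma pointwiseApply_apply (B : G →L[ℝ] E →L[ℝ] F) (A : C(K, G)) (γ : C(K, E)) (s : K) :
    pointwiseApply B A γ s = B (A s) (γ s) := rfl

/-- The derivative of the superposition operator `γ ↦ f ∘ γ` in the direction `η` is obtained by
applying, at each point, the derivative of `f` along `γ` to `η`. The map `B` identifies the values
of `f'` with linear maps. -/
lemma hasFDerivAt_postcomp (B : G →L[ℝ] E →L[ℝ] F) {f : C(E, F)} {f' : C(E, G)}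
    (hf : ∀ x, HasFDerivAt f (B (f' x)) x) (γ : C(K, E)) :
    HasFDerivAt (fun γ : C(K, E) => f.comp γ) (pointwiseApply B (f'.comp γ)) γ := by
  rw [hasFDerivAt_iff_isLittleO_nhds_zero, Asymptotics.isLittleO_iff]
  intro ε hε
  have hc : Continuous (fun γ : C(K, E) => f'.comp γ) := ContinuousMap.continuous_postcomp f'
  have hε' : 0 < ε / (‖B‖ + 1) := by positivity
  obtain ⟨δ, hδ, h⟩ := Metric.continuousAt_iff.1 (hc.continuousAt (x := γ)) _ hε'
  filter_upwards [Metric.ball_mem_nhds 0 hδ] with η hη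
  rw [mem_ball_zero_iff] at hη
  rw [ContinuousMap.norm_le _ (by positivity)]
  intro s
  -- perturbing `γ` by constants controls `f'` on the whole ball around `γ s`
  have hb : ∀ v ∈ Metric.ball (γ s) δ, ‖B (f' v) - B (f' (γ s))‖ ≤ ε := by
    intro v hv
    have h1 : dist (γ + ContinuousMap.const K (v - γ s)) γ < δ := by
      rw [dist_eq_norm, add_sub_cancel_left, ContinuousMap.norm_lt_iff _ hδ]
      intro r
      simpa [dist_eq_norm] using hv
    have h2 := (ContinuousMap.dist_lt_iff hε').1 (h h1) s
    have h3 : ‖f' v - f' (γ s)‖ ≤ ε / (‖B‖ + 1) := by simpa [dist_eq_norm] using h2.le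
    rw [← map_sub]
    calc ‖B (f' v - f' (γ s))‖ ≤ ‖B‖ * (ε / (‖B‖ + 1)) := B.le_opNorm_of_le h3
      _ ≤ (‖B‖ + 1) * (ε / (‖B‖ + 1)) := by gcongr; linarith
      _ = ε := by field_simp
  have h3 := Convex.norm_image_sub_le_of_norm_hasFDerivWithin_le'
    (f := f) (f' := fun x => B (f' x)) (φ := B (f' (γ s))) (x := γ s) (y := γ s + η s)
    (fun v _ => (hf v).hasFDerivWithinAt) hb (convex_ball _ _) (Metric.mem_ball_self hδ)
    (by simpa [dist_eq_norm] using (η.norm_coe_le_norm s).trans_lt hη)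
  rw [add_sub_cancel_left] at h3
  refine le_trans ?_ (h3.trans ?_)
  · simp
  · gcongr
    exact η.norm_coe_le_norm s

lemma contDiff_postcomp_succ (B : G →L[ℝ] E →L[ℝ] F) {f : C(E, F)} {f' : C(E, G)}
    (hf : ∀ x, HasFDerivAt f (B (f' x)) x) {n : ℕ}
    (h : ContDiff ℝ n (fun γ : C(K, E) => f'.comp γ)) :
    ContDiff ℝ (n + 1) (fun γ : C(K, E) => f.comp γ) :=
  contDiff_succ_iff_hasFDerivAt.2 ⟨fun γ => pointwiseApply B (f'.comp γ),
    (pointwiseApply (K := K) B).contDiff.comp h, hasFDerivAt_postcomp B hf⟩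

lemma contDiff_postcomp_nat (n : ℕ) {f : E → F} (hf : ContDiff ℝ n f) :
    ContDiff ℝ n (fun γ : C(K, E) => (⟨f, hf.continuous⟩ : C(E, F)).comp γ) := by
  induction n generalizing F with
  | zero =>
    exact contDiff_zero.2 (ContinuousMap.continuous_postcomp _)
  | succ n ih =>
    have hf1 : ContDiff ℝ ((n : ℕ∞ω) + 1) f := by exact_mod_cast hf
    obtain ⟨hd, -, h'⟩ := contDiff_succ_iff_fderiv.1 hf1
    exact contDiff_postcomp_succ (ContinuousLinearMap.id ℝ (E →L[ℝ] F))
      (fun x => (hd x).hasFDerivAt) (ih h')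

/-- Composition with a smooth map is a smooth operator between spaces of continuous maps. -/
theorem contDiff_postcomp {f : E → F} (hf : ContDiff ℝ ∞ f) :
    ContDiff ℝ ∞ (fun γ : C(K, E) => (⟨f, hf.continuous⟩ : C(E, F)).comp γ) :=
  contDiff_infty.2 fun n => contDiff_postcomp_nat n (hf.of_le (by exact_mod_cast le_top))

end Superposition

/-! ### The inverse function theorem on open sets -/

section InverseFunction

variable {E F : Type*} [NormedAddCommGroup E] [NormedSpace ℝ E] [CompleteSpace E]
  [NormedAddCommGroup F] [NormedSpace ℝ F]

/-- The inverse function theorem, with an inverse which is smooth on a whole neighbourhood: the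
`C^∞` regularity of the local inverse at one point does not by itself give this. -/
theorem exists_openPartialHomeomorph_of_contDiffOn {f : E → F} {s : Set E} (hs : IsOpen s)
    (hf : ContDiffOn ℝ ∞ f s) {a : E} (ha : a ∈ s) {f' : E ≃L[ℝ] F}
    (hf' : HasFDerivAt f (f' : E →L[ℝ] F) a) :
    ∃ φ : OpenPartialHomeomorph E F, (φ : E → F) = f ∧ a ∈ φ.source ∧ φ.source ⊆ s ∧
      ContDiffOn ℝ ∞ φ.symm φ.target := by
  have hfa : ContDiffAt ℝ ∞ f a := hf.contDiffAt (hs.mem_nhds ha)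
  let φ₀ := hfa.toOpenPartialHomeomorph f hf' (by simp)
  have hφ₀ : (φ₀ : E → F) = f := rfl
  have ha₀ : a ∈ φ₀.source := hfa.mem_toOpenPartialHomeomorph_source hf' (by simp)
  let t : Set E := {x ∈ s | fderiv ℝ f x ∈ range ((↑) : (E ≃L[ℝ] F) → (E →L[ℝ] F))}
  have ht : IsOpen t :=
    (hf.continuousOn_fderiv_of_isOpen hs (by simp)).isOpen_inter_preimage hs
      ContinuousLinearEquiv.isOpen
  have hat : a ∈ t := ⟨ha, f', hf'.fderiv.symm⟩
  refine ⟨φ₀.restrOpen t ht, hφ₀, ⟨ha₀, hat⟩, fun x hx => hx.2.1, fun y hy => ?_⟩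
  set φ := φ₀.restrOpen t ht
  have hx : φ.symm y ∈ φ.source := φ.map_target hy
  obtain ⟨hxs, g', hg'⟩ := hx.2
  have hfx : ContDiffAt ℝ ∞ f (φ.symm y) := hf.contDiffAt (hs.mem_nhds hxs)
  refine (φ.contDiffAt_symm (f₀' := g') hy ?_ hfx).contDiffWithinAt
  rw [hg']
  exact (hfx.differentiableAt (by simp)).hasFDerivAt

end InverseFunction

/-! ### Smooth local flows -/

section Flow

/-- The interval on which integral curves are parametrised. -/
abbrev TimeInterval : Type := Icc (-1 : ℝ) 1

/-- Extension of a curve on `[-1, 1]` to the real line, constant beyond the end points. -/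
abbrev extendCurve {E : Type*} [TopologicalSpace E] (γ : C(TimeInterval, E)) : ℝ → E :=
  IccExtend (by norm_num : (-1 : ℝ) ≤ 1) γ

lemma continuous_extendCurve {E : Type*} [TopologicalSpace E] (γ : C(TimeInterval, E)) :
    Continuous (extendCurve γ) :=
  γ.continuous.Icc_extend'

variable {E : Type u} [NormedAddCommGroup E] [NormedSpace ℝ E]

/-- The operator sending a curve `γ` on `[-1, 1]` to its primitive vanishing at `0`. -/
def primitiveCLM : C(TimeInterval, E) →L[ℝ] C(TimeInterval, E) :=
  LinearMap.mkContinuous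
    { toFun := fun γ => ⟨fun s => ∫ r in (0 : ℝ)..s, extendCurve γ r,
        (intervalIntegral.continuous_primitive
          (fun a b => (continuous_extendCurve γ).intervalIntegrable a b) 0).comp
          continuous_subtype_val⟩
      map_add' := fun γ η => by
        ext s
        exact intervalIntegral.integral_add ((continuous_extendCurve γ).intervalIntegrable _ _)
          ((continuous_extendCurve η).intervalIntegrable _ _)
      map_smul' := fun c γ => by
        ext s
        exact intervalIntegral.integral_smul c _ } 1
    (fun γ => by
      rw [one_mul, ContinuousMap.norm_le _ (norm_nonneg _)]
      intro s
      refine (intervalIntegral.norm_integral_le_of_norm_le_const (C := ‖γ‖)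
        (fun r _ => γ.norm_coe_le_norm _)).trans ?_
      have : |(s : ℝ) - 0| ≤ 1 := by rw [sub_zero, abs_le]; exact ⟨s.2.1, s.2.2⟩
      exact mul_le_of_le_one_right (norm_nonneg _) this)

lemma primitiveCLM_apply (γ : C(TimeInterval, E)) (s : TimeInterval) :
    primitiveCLM γ s = ∫ r in (0 : ℝ)..s, extendCurve γ r := rfl

/-- The inclusion of constant curves. -/
def constCurveCLM : E →L[ℝ] C(TimeInterval, E) :=
  LinearMap.mkContinuous
    { toFun := fun x => ContinuousMap.const _ x
      map_add' := fun _ _ => rfl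
      map_smul' := fun _ _ => rfl } 1
    (fun x => by
      rw [one_mul, ContinuousMap.norm_le _ (norm_nonneg _)]
      exact fun _ => le_rfl)

lemma constCurveCLM_apply (x : E) (s : TimeInterval) : constCurveCLM x s = x := rfl

variable [CompleteSpace E]

/-- Near a constant curve, the curves `γ` on `[-1, 1]` with `γ' = λ X(γ)` and `γ(0) = q` depend
smoothly on `(λ, q)`, and are unique. -/
lemma exists_smooth_family_of_integral_equation {X : E → E} (hX : ContDiff ℝ ∞ X) (y₀ : E) :
    ∃ (Γ : ℝ × E → C(TimeInterval, E)) (ρ r : ℝ), 0 < ρ ∧ 0 < r ∧ r ≤ ρ ∧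
      ContDiffOn ℝ ∞ Γ (Metric.ball (0, y₀) r) ∧
      (∀ p ∈ Metric.ball ((0 : ℝ), y₀) r, Γ p ∈ Metric.ball (constCurveCLM y₀) ρ ∧
        Γ p = constCurveCLM p.2 + p.1 • primitiveCLM ((⟨X, hX.continuous⟩ : C(E, E)).comp (Γ p))) ∧
      ∀ p ∈ Metric.ball ((0 : ℝ), y₀) r, ∀ γ ∈ Metric.ball (constCurveCLM y₀) ρ,
        γ = constCurveCLM p.2 + p.1 • primitiveCLM ((⟨X, hX.continuous⟩ : C(E, E)).comp γ) →
        γ = Γ p := by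
  let S : C(TimeInterval, E) → C(TimeInterval, E) :=
    fun γ => primitiveCLM ((⟨X, hX.continuous⟩ : C(E, E)).comp γ)
  have hS : ContDiff ℝ ∞ S :=
    (primitiveCLM (E := E)).contDiff.comp (contDiff_postcomp (K := TimeInterval) hX)
  let Θ : (ℝ × E) × C(TimeInterval, E) → (ℝ × E) × C(TimeInterval, E) :=
    fun p => (p.1, p.2 - constCurveCLM p.1.2 - p.1.1 • S p.2)
  have hΘ : ContDiff ℝ ∞ Θ := by
    refine contDiff_fst.prodMk ((contDiff_snd.sub ?_).sub ?_)
    · exact (constCurveCLM (E := E)).contDiff.comp (contDiff_snd.comp contDiff_fst)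
    · exact (contDiff_fst.comp contDiff_fst).smul (hS.comp contDiff_snd)
  set a : (ℝ × E) × C(TimeInterval, E) := ((0, y₀), constCurveCLM y₀) with ha
  -- the derivative at `a` is triangular, with the identity on the diagonal
  let T : (ℝ × E) →L[ℝ] C(TimeInterval, E) :=
    (constCurveCLM (E := E)).comp (ContinuousLinearMap.snd ℝ ℝ E) +
      (ContinuousLinearMap.fst ℝ ℝ E).smulRight (S (constCurveCLM y₀))
  let P := ContinuousLinearMap.fst ℝ (ℝ × E) C(TimeInterval, E)
  let Q := ContinuousLinearMap.snd ℝ (ℝ × E) C(TimeInterval, E)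
  let Θ' : ((ℝ × E) × C(TimeInterval, E)) ≃L[ℝ] ((ℝ × E) × C(TimeInterval, E)) :=
    ContinuousLinearEquiv.equivOfInverse (P.prod (Q - T.comp P)) (P.prod (Q + T.comp P))
      (fun p => by simp [P, Q]) (fun p => by simp [P, Q])
  have hΘ' : HasFDerivAt Θ (Θ' : _ →L[ℝ] _) a := by
    have h1 : HasFDerivAt (fun p : (ℝ × E) × C(TimeInterval, E) => p.1) P a := P.hasFDerivAt
    have h2 : HasFDerivAt (fun p : (ℝ × E) × C(TimeInterval, E) => p.2) Q a := Q.hasFDerivAt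
    have h3 : HasFDerivAt (fun p : (ℝ × E) × C(TimeInterval, E) => constCurveCLM p.1.2)
        ((constCurveCLM (E := E)).comp ((ContinuousLinearMap.snd ℝ ℝ E).comp P)) a :=
      ((constCurveCLM (E := E)).comp ((ContinuousLinearMap.snd ℝ ℝ E).comp P)).hasFDerivAt
    have h4 : HasFDerivAt (fun p : (ℝ × E) × C(TimeInterval, E) => p.1.1)
        ((ContinuousLinearMap.fst ℝ ℝ E).comp P) a :=
      ((ContinuousLinearMap.fst ℝ ℝ E).comp P).hasFDerivAt
    have h5 := ((hS.differentiable (by simp)) a.2).hasFDerivAt.comp a h2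
    refine (h1.prodMk ((h2.sub h3).sub (h4.smul h5))).congr_fderiv ?_
    ext p <;> simp [Θ', T, P, Q, ha]
  obtain ⟨φ, hφ, haφ, -, hsymm⟩ :=
    exists_openPartialHomeomorph_of_contDiffOn isOpen_univ hΘ.contDiffOn (mem_univ a) hΘ'
  have hΘa : Θ a = ((0, y₀), 0) := by simp [Θ, ha]
  obtain ⟨ρ, hρ, hρφ⟩ := Metric.isOpen_iff.1 φ.open_source a haφ
  have hmem : ((0, y₀), (0 : C(TimeInterval, E))) ∈ φ.target := by
    rw [← hΘa, ← hφ]; exact φ.map_source haφ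
  have hsa : φ.symm ((0, y₀), 0) = a := by
    rw [← hΘa, ← hφ]; exact φ.left_inv haφ
  let j : ℝ × E → (ℝ × E) × C(TimeInterval, E) := fun p => (p, 0)
  have hj : ContDiff ℝ ∞ j := contDiff_id.prodMk contDiff_const
  have hopen : IsOpen (φ.target ∩ φ.symm ⁻¹' Metric.ball a ρ) :=
    φ.isOpen_inter_preimage_symm Metric.isOpen_ball
  obtain ⟨r, hr, hrW⟩ := Metric.isOpen_iff.1 (hopen.preimage hj.continuous) (0, y₀)
    ⟨hmem, by
      change φ.symm ((0, y₀), 0) ∈ Metric.ball a ρ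
      rw [hsa]
      exact Metric.mem_ball_self hρ⟩
  have hsub : Metric.ball ((0 : ℝ), y₀) (min r ρ) ⊆ Metric.ball (0, y₀) r :=
    Metric.ball_subset_ball (min_le_left _ _)
  have hfst : ∀ p ∈ Metric.ball ((0 : ℝ), y₀) (min r ρ), (φ.symm (j p)).1 = p ∧
      (φ.symm (j p)).2 - constCurveCLM p.2 - p.1 • S (φ.symm (j p)).2 = 0 := by
    intro p hp
    have h := φ.right_inv (hrW (hsub hp)).1
    rw [hφ] at h
    have h1 : (φ.symm (j p)).1 = p := congrArg Prod.fst h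
    have h2 := congrArg Prod.snd h
    simp only [Θ, h1] at h2
    exact ⟨h1, h2⟩
  refine ⟨fun p => (φ.symm (j p)).2, ρ, min r ρ, hρ, lt_min hr hρ, min_le_right _ _, ?_, ?_, ?_⟩
  · have h : ContDiffOn ℝ ∞ (fun p => φ.symm (j p)) (Metric.ball ((0 : ℝ), y₀) (min r ρ)) :=
      hsymm.comp hj.contDiffOn fun p hp => (hrW (hsub hp)).1
    exact contDiff_snd.comp_contDiffOn h
  · intro p hp
    have h2 := (hrW (hsub hp)).2
    rw [mem_preimage, ha, ← ball_prod_same] at h2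
    refine ⟨h2.2, ?_⟩
    have h3 := (hfst p hp).2
    rw [sub_sub, sub_eq_zero] at h3
    exact h3
  · intro p hp γ hγ hγe
    have hpγ : (p, γ) ∈ φ.source := by
      apply hρφ
      rw [ha, ← ball_prod_same]
      exact ⟨Metric.ball_subset_ball (min_le_right _ _) hp, hγ⟩
    have h1 : φ (p, γ) = j p := by
      rw [hφ]
      simp only [Θ, j]
      rw [sub_sub, sub_eq_zero.2 hγe]
    change γ = (φ.symm (j p)).2
    rw [← h1, φ.left_inv hpγ]

/-- A smooth vector field has a smooth local flow. With `J` the primitive operator, the curve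
`s ↦ Φ(sλ, q)` on `[-1, 1]` is the zero `γ` of `(λ, q, γ) ↦ γ - q - λ J(X ∘ γ)`, a smooth map
whose derivative in `γ` is the identity at `λ = 0`; hence `γ`, and `Φ(λ, q) = γ(1)`,
depend smoothly on `(λ, q)`. -/
theorem exists_contDiffOn_flow {X : E → E} (hX : ContDiff ℝ ∞ X) (y₀ : E) :
    ∃ (Φ : ℝ × E → E) (W : Set (ℝ × E)), IsOpen W ∧ (0, y₀) ∈ W ∧ ContDiffOn ℝ ∞ Φ W ∧
      (∀ p ∈ W, HasDerivAt (fun s => Φ (s, p.2)) (X (Φ p)) p.1) ∧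
      ∀ q, (0, q) ∈ W → Φ (0, q) = q := by
  obtain ⟨Γ, ρ, r, hρ, hr, hrρ, hΓ, hΓe, hΓu⟩ := exists_smooth_family_of_integral_equation hX y₀
  have hI : (-1 : ℝ) ≤ 1 := by norm_num
  have h1 : (1 : ℝ) ∈ Icc (-1 : ℝ) 1 := ⟨hI, le_rfl⟩
  have hsub : Metric.ball ((0 : ℝ), y₀) (r / 2) ⊆ Metric.ball (0, y₀) r :=
    Metric.ball_subset_ball (by linarith)
  -- the time `σ` flow is read off the curve of parameter `r / 2`, by rescaling time
  have key : ∀ q ∈ Metric.ball y₀ (r / 2), ∀ σ ∈ Metric.ball (0 : ℝ) (r / 2),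
      Γ (σ, q) ⟨1, h1⟩ = extendCurve (Γ (r / 2, q)) (σ / (r / 2)) := by
    intro q hq σ hσ
    have hp : ((r / 2, q) : ℝ × E) ∈ Metric.ball ((0 : ℝ), y₀) r := by
      rw [← ball_prod_same]
      refine ⟨?_, Metric.ball_subset_ball (by linarith) hq⟩
      rw [mem_ball_zero_iff, Real.norm_eq_abs, abs_of_pos] <;> linarith
    obtain ⟨hb, he⟩ := hΓe _ hp
    set γ := Γ (r / 2, q)
    set s := σ / (r / 2) with hs
    have hs1 : |s| ≤ 1 := by
      rw [hs, abs_div, abs_of_pos (by linarith : 0 < r / 2), div_le_one (by linarith)]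
      rw [mem_ball_zero_iff, Real.norm_eq_abs] at hσ
      exact hσ.le
    have hσs : σ = s * (r / 2) := by rw [hs]; field_simp
    -- the rescaled curve solves the integral equation for `(σ, q)`, so uniqueness applies
    let γs : C(TimeInterval, E) := ⟨fun x => extendCurve γ (s * x),
      (continuous_extendCurve γ).comp (by fun_prop)⟩
    have hγs : γs = Γ (σ, q) := by
      refine hΓu (σ, q) ?_ γs ?_ ?_
      · rw [← ball_prod_same]
        exact ⟨Metric.ball_subset_ball (by linarith) hσ,
          Metric.ball_subset_ball (by linarith) hq⟩
      · rw [Metric.mem_ball, ContinuousMap.dist_lt_iff hρ] at hb ⊢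
        exact fun x => hb _
      · ext x
        have hmem : ∀ y : ℝ, |y| ≤ 1 → s * y ∈ Icc (-1 : ℝ) 1 := fun y hy => by
          rw [mem_Icc, ← abs_le, abs_mul]
          exact mul_le_one₀ hs1 (abs_nonneg _) hy
        have hx := hmem x (abs_le.2 x.2)
        have h2 := congrArg (fun η : C(TimeInterval, E) => η ⟨s * x, hx⟩) he
        simp only [ContinuousMap.add_apply, ContinuousMap.smul_apply, constCurveCLM_apply,
          primitiveCLM_apply] at h2
        have h3 : γs x = γ ⟨s * x, hx⟩ := IccExtend_of_mem hI γ hx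
        rw [h3, h2]
        simp only [ContinuousMap.add_apply, ContinuousMap.smul_apply, constCurveCLM_apply,
          primitiveCLM_apply]
        congr 1
        rw [hσs, mul_comm, mul_smul, mul_comm, ← mul_zero s,
          ← intervalIntegral.smul_integral_comp_mul_left, smul_comm, mul_zero]
        congr 2
        refine intervalIntegral.integral_congr fun y hy => ?_
        have hy1 : |y| ≤ 1 := by
          have hx' := abs_le.2 x.2
          have := abs_sub_left_of_mem_uIcc hy
          simp only [sub_zero] at this
          exact this.trans hx'
        have hyI : y ∈ Icc (-1 : ℝ) 1 := abs_le.1 hy1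
        simp only [extendCurve]
        rw [IccExtend_of_mem hI _ (hmem y hy1), IccExtend_of_mem hI _ hyI]
        change X (γ _) = X (IccExtend hI γ (s * y))
        rw [IccExtend_of_mem hI _ (hmem y hy1)]
    rw [← hγs]
    change extendCurve γ (s * 1) = _
    rw [mul_one]
  refine ⟨fun p => Γ p ⟨1, h1⟩, Metric.ball (0, y₀) (r / 2), Metric.isOpen_ball,
    Metric.mem_ball_self (by linarith), ?_, ?_, ?_⟩
  · exact (ContinuousMap.evalCLM ℝ (⟨1, h1⟩ : TimeInterval)).contDiff.comp_contDiffOn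
      (hΓ.mono hsub)
  · rintro ⟨t, q⟩ hp
    rw [← ball_prod_same] at hp
    obtain ⟨ht, hq⟩ := hp
    have hp : ((r / 2, q) : ℝ × E) ∈ Metric.ball ((0 : ℝ), y₀) r := by
      rw [← ball_prod_same]
      refine ⟨?_, Metric.ball_subset_ball (by linarith) hq⟩
      rw [mem_ball_zero_iff, Real.norm_eq_abs, abs_of_pos] <;> linarith
    obtain ⟨-, he⟩ := hΓe _ hp
    have hkt := key q hq t ht
    dsimp only at hkt ⊢
    rw [hkt]
    set γ := Γ (r / 2, q)
    have hXc : Continuous fun x => X (extendCurve γ x) :=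
      hX.continuous.comp (continuous_extendCurve γ)
    have hd : HasDerivAt (fun σ => q + (r / 2) • ∫ x in (0 : ℝ)..σ / (r / 2), X (extendCurve γ x))
        (X (extendCurve γ (t / (r / 2)))) t := by
      have h2 := (hXc.integral_hasStrictDerivAt 0 (t / (r / 2))).hasDerivAt
      have h3 := ((h2.scomp t ((hasDerivAt_id t).div_const (r / 2))).const_smul (r / 2)).const_add q
      convert! h3 using 1
      rw [smul_smul, mul_one_div_cancel (by linarith), one_smul]
    refine hd.congr_of_eventuallyEq ?_
    filter_upwards [Metric.isOpen_ball.mem_nhds ht] with σ hσ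
    rw [key q hq σ hσ]
    have hσI : σ / (r / 2) ∈ Icc (-1 : ℝ) 1 := by
      rw [mem_Icc, ← abs_le, abs_div, abs_of_pos (by linarith : 0 < r / 2),
        div_le_one (by linarith)]
      rw [mem_ball_zero_iff, Real.norm_eq_abs] at hσ
      exact hσ.le
    have h2 := congrArg (fun η : C(TimeInterval, E) => η ⟨_, hσI⟩) he
    simp only [extendCurve]
    rw [IccExtend_of_mem hI _ hσI]
    exact h2
  · intro q hq
    have h2 := (hΓe _ (hsub hq)).2
    simp only [zero_smul, add_zero] at h2
    change Γ (0, q) ⟨1, h1⟩ = q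
    rw [h2, constCurveCLM_apply]

end Flow

/-! ### First integrals of a vector field -/

section FirstIntegrals

/-- A map smooth near a point has the same germ there as a globally smooth map. -/
lemma exists_contDiff_eventuallyEq {E F : Type*} [NormedAddCommGroup E] [NormedSpace ℝ E]
    [FiniteDimensional ℝ E] [NormedAddCommGroup F] [NormedSpace ℝ F] {f : E → F} {V : Set E}
    (hV : IsOpen V) (hf : ContDiffOn ℝ ∞ f V) {a : E} (ha : a ∈ V) :
    ∃ f₁ : E → F, ContDiff ℝ ∞ f₁ ∧ f₁ =ᶠ[nhds a] f := by
  obtain ⟨r, hr, hrV⟩ := Metric.nhds_basis_closedBall.mem_iff.1 (hV.mem_nhds ha)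
  let b : ContDiffBump a := ⟨r / 2, r, by linarith, by linarith⟩
  refine ⟨fun y => b y • f y, contDiff_iff_contDiffAt.2 fun y => ?_, ?_⟩
  · by_cases hy : y ∈ V
    · exact b.contDiffAt.smul (hf.contDiffAt (hV.mem_nhds hy))
    · have h0 : (fun y => b y • f y) =ᶠ[nhds y] fun _ => 0 := by
        have hy' : y ∉ tsupport b := fun h => hy (hrV (by simpa [b.tsupport_eq, b] using h))
        filter_upwards [(isClosed_tsupport b).isOpen_compl.mem_nhds hy'] with z hz
        rw [image_eq_zero_of_notMem_tsupport hz, zero_smul]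
      exact contDiffAt_const.congr_of_eventuallyEq h0
  · filter_upwards [b.eventuallyEq_one] with y hy
    rw [hy, Pi.one_apply, one_smul]

/-- Linear coordinates `ℝ × F` on `E` in which `v` is the first basis direction. -/
lemma exists_equiv_apply_one_zero {E F : Type*} [NormedAddCommGroup E] [NormedSpace ℝ E]
    [FiniteDimensional ℝ E] [NormedAddCommGroup F] [NormedSpace ℝ F] [FiniteDimensional ℝ F]
    (h : Module.finrank ℝ E = Module.finrank ℝ F + 1) {v : E} (hv : v ≠ 0) :
    ∃ A : (ℝ × F) ≃L[ℝ] E, A (1, 0) = v := by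
  obtain ⟨K, hK⟩ := (Submodule.span ℝ {v}).exists_isCompl
  have hfin : Module.finrank ℝ F = Module.finrank ℝ K := by
    have h1 := Submodule.finrank_add_eq_of_isCompl hK
    rw [finrank_span_singleton hv] at h1
    omega
  let B : (ℝ × F) ≃ₗ[ℝ] E :=
    ((LinearEquiv.toSpanNonzeroSingleton ℝ E v hv).prodCongr
      (LinearEquiv.ofFinrankEq F K hfin)).trans
        (Submodule.prodEquivOfIsCompl _ _ hK)
  refine ⟨B.toContinuousLinearEquiv, ?_⟩
  change B (1, 0) = v
  simp [B]

variable {E F : Type u} [NormedAddCommGroup E] [NormedSpace ℝ E] [FiniteDimensional ℝ E]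
  [NormedAddCommGroup F] [NormedSpace ℝ F] [FiniteDimensional ℝ F]

/-- Near a point where it does not vanish, a smooth vector field on a space of dimension `d + 1`
has `d` independent smooth first integrals: the flow started on a transverse hyperplane gives
coordinates `(t, z)`, and `z` is constant along the flow. -/
theorem exists_first_integrals (hdim : Module.finrank ℝ E = Module.finrank ℝ F + 1)
    {X : E → E} {V : Set E} (hV : IsOpen V) (hX : ContDiffOn ℝ ∞ X V) {y₀ : E} (hy₀ : y₀ ∈ V)
    (hne : X y₀ ≠ 0) :
    ∃ (x : E → F) (W : Set E), IsOpen W ∧ y₀ ∈ W ∧ W ⊆ V ∧ ContDiffOn ℝ ∞ x W ∧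
      (∀ y ∈ W, fderiv ℝ x y (X y) = 0) ∧
      ∀ v, fderiv ℝ x y₀ v = 0 → ∃ c : ℝ, v = c • X y₀ := by
  have : CompleteSpace E := FiniteDimensional.complete ℝ E
  have : CompleteSpace F := FiniteDimensional.complete ℝ F
  obtain ⟨A, hA⟩ := exists_equiv_apply_one_zero (F := F) hdim hne
  obtain ⟨X₁, hX₁, hXX₁⟩ := exists_contDiff_eventuallyEq hV hX hy₀
  obtain ⟨V₁, hV₁s, hV₁, hy₀V₁⟩ := eventually_nhds_iff.1 hXX₁
  obtain ⟨Φ, W, hW, h0W, hΦ, hΦX, hΦ0⟩ := exists_contDiffOn_flow hX₁ y₀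
  let j : ℝ × F → ℝ × E := fun p => (p.1, y₀ + A (0, p.2))
  have hj : ContDiff ℝ ∞ j := by
    refine contDiff_fst.prodMk (contDiff_const.add ?_)
    exact A.contDiff.comp (contDiff_const.prodMk contDiff_snd)
  have hj0 : j 0 = (0, y₀) := by simp [j, ← Prod.zero_eq_mk]
  have hWj : IsOpen (j ⁻¹' W) := hW.preimage hj.continuous
  have h0 : (0 : ℝ × F) ∈ j ⁻¹' W := by rw [mem_preimage, hj0]; exact h0W
  have hΨ : ContDiffOn ℝ ∞ (Φ ∘ j) (j ⁻¹' W) := hΦ.comp hj.contDiffOn fun _ h => h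
  have hd : DifferentiableAt ℝ (Φ ∘ j) 0 :=
    (hΨ.contDiffAt (hWj.mem_nhds h0)).differentiableAt (by simp)
  have hder : ∀ p ∈ j ⁻¹' W, HasDerivAt (fun s => (Φ ∘ j) (s, p.2)) (X₁ (Φ (j p))) p.1 :=
    fun p hp => hΦX (j p) hp
  -- at the origin, the flow started on the hyperplane is tangent to the affine map `y₀ + A`
  have hΨ' : HasFDerivAt (Φ ∘ j) (A : ℝ × F →L[ℝ] E) 0 := by
    refine hd.hasFDerivAt.congr_fderiv ?_
    have h1 : fderiv ℝ (Φ ∘ j) 0 (1, 0) = A (1, 0) := by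
      have h2 := hder 0 h0
      have h3 : HasDerivAt (fun s : ℝ => ((s, 0) : ℝ × F)) (1, 0) 0 :=
        (hasDerivAt_id (0 : ℝ)).prodMk (hasDerivAt_const (0 : ℝ) (0 : F))
      have h4 := hd.hasFDerivAt.comp_hasDerivAt (0 : ℝ) h3
      rw [h4.unique h2, hj0, hΦ0 _ h0W, hA, hV₁s y₀ hy₀V₁]
    have h2 : ∀ z, fderiv ℝ (Φ ∘ j) 0 (0, z) = A (0, z) := by
      intro z
      have h3 : HasDerivAt (fun s : ℝ => ((0, s • z) : ℝ × F)) (0, z) 0 := by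
        have := (hasDerivAt_const (0 : ℝ) (0 : ℝ)).prodMk ((hasDerivAt_id (0 : ℝ)).smul_const z)
        simpa using this
      have h4 := HasFDerivAt.comp_hasDerivAt_of_eq (0 : ℝ) hd.hasFDerivAt h3
        (by rw [zero_smul]; rfl)
      have h5 : HasDerivAt (fun s : ℝ => y₀ + s • A (0, z)) (A (0, z)) 0 := by
        simpa using ((hasDerivAt_id (0 : ℝ)).smul_const (A (0, z))).const_add y₀
      refine h4.unique (h5.congr_of_eventuallyEq ?_)
      have hc : Continuous fun s : ℝ => ((0, s • z) : ℝ × F) := by fun_prop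
      filter_upwards [(hWj.preimage hc).mem_nhds
        (by rw [mem_preimage, zero_smul]; exact h0)] with s hs
      have h6 := hΦ0 _ hs
      have h7 : ((0, s • z) : ℝ × F) = s • (0, z) := by simp
      simp only [Function.comp, j] at h6 ⊢
      rw [h6, h7, map_smul]
    ext z
    · simpa using h1
    · simpa using h2 z
  obtain ⟨φ, hφ, h0φ, hφs, hsymm⟩ := exists_openPartialHomeomorph_of_contDiffOn hWj hΨ h0 hΨ'
  have hφ0 : φ 0 = y₀ := by
    rw [hφ, Function.comp, hj0, hΦ0 _ h0W]
  have hy₀t : y₀ ∈ φ.target := hφ0 ▸ φ.map_source h0φ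
  have hs0 : φ.symm y₀ = 0 := by rw [← hφ0, φ.left_inv h0φ]
  have hdiff : ∀ y ∈ φ.target, DifferentiableAt ℝ φ.symm y := fun y hy =>
    (hsymm.contDiffAt (φ.open_target.mem_nhds hy)).differentiableAt (by simp)
  have hfd : ∀ y ∈ φ.target, fderiv ℝ (fun y => (φ.symm y).2) y =
      (ContinuousLinearMap.snd ℝ ℝ F).comp (fderiv ℝ φ.symm y) := fun y hy =>
    ((hasFDerivAt_snd (p := φ.symm y)).comp y (hdiff y hy).hasFDerivAt).fderiv
  refine ⟨fun y => (φ.symm y).2, φ.target ∩ (V ∩ V₁), φ.open_target.inter (hV.inter hV₁),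
    ⟨hy₀t, hy₀, hy₀V₁⟩, fun y hy => hy.2.1, ?_, ?_, ?_⟩
  · exact contDiff_snd.comp_contDiffOn (hsymm.mono inter_subset_left)
  · intro y hy
    have hp := φ.map_target hy.1
    have h1 := hder _ (hφs hp)
    have h2 : Φ (j (φ.symm y)) = y := by
      have := φ.right_inv hy.1
      rwa [hφ] at this
    rw [h2, hV₁s y hy.2.2] at h1
    have h3 := HasFDerivAt.comp_hasDerivAt_of_eq _ (hdiff y hy.1).hasFDerivAt h1 h2.symm
    have h4 : HasDerivAt (fun s : ℝ => (s, (φ.symm y).2)) (1, 0) (φ.symm y).1 :=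
      (hasDerivAt_id _).prodMk (hasDerivAt_const _ _)
    have hc : Continuous fun s : ℝ => (s, (φ.symm y).2) := by fun_prop
    have h5 : fderiv ℝ φ.symm y (X y) = (1, 0) := by
      refine h3.unique (h4.congr_of_eventuallyEq ?_)
      filter_upwards [(φ.open_source.preimage hc).mem_nhds hp] with s hs
      rw [Function.comp, ← hφ, φ.left_inv hs]
    rw [hfd y hy.1, ContinuousLinearMap.comp_apply, h5]
    rfl
  · intro v hv
    have h1 : HasFDerivAt φ.symm (A.symm : E →L[ℝ] ℝ × F) y₀ := by
      refine φ.hasFDerivAt_symm hy₀t ?_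
      rw [hs0, hφ]
      exact hΨ'
    rw [hfd y₀ hy₀t, h1.fderiv] at hv
    refine ⟨(A.symm v).1, ?_⟩
    have h2 : A.symm v = (A.symm v).1 • (1, 0) := by
      ext
      · simp
      · simpa using hv
    rw [← hA, ← map_smul, ← h2, A.apply_symm_apply]

end FirstIntegrals

/-! ### Covariant differentials on an open set of a vector space -/

section CovariantDifferential

variable {E : Type*} [NormedAddCommGroup E] [NormedSpace ℝ E]

/-- The covariant derivative `(∇ᵥ X♭)(w)` for the Levi-Civita connection of a field `G` of
bilinear forms on a vector space, in the form `½ (∂ᵥG(X, w) - ∂_wG(X, v) + ∂_XG(v, w)) + G(∂ᵥX, w)`,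
where the inverse metric has been eliminated. -/
def covDifferential (G : E → E →L[ℝ] E →L[ℝ] ℝ) (X : E → E) (y v w : E) : ℝ :=
  (1 / 2) * (fderiv ℝ G y v (X y) w - fderiv ℝ G y w (X y) v + fderiv ℝ G y (X y) v w)
    + G y (fderiv ℝ X y v) w

lemma fderiv_lower_apply {G : E → E →L[ℝ] E →L[ℝ] ℝ} {X : E → E} {y : E}
    (hG : DifferentiableAt ℝ G y) (hX : DifferentiableAt ℝ X y) (v w : E) :
    fderiv ℝ (fun z => G z (X z)) y v w = fderiv ℝ G y v (X y) w + G y (fderiv ℝ X y v) w := by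
  rw [(hG.hasFDerivAt.clm_apply hX.hasFDerivAt).fderiv]
  simp [add_comm]

/-- The antisymmetric part of the covariant differential is the exterior derivative of `X♭`. -/
lemma covDifferential_sub_swap {G : E → E →L[ℝ] E →L[ℝ] ℝ} {X : E → E} {y : E}
    (hG : DifferentiableAt ℝ G y) (hX : DifferentiableAt ℝ X y)
    (hsymm : ∀ v w u, fderiv ℝ G y u v w = fderiv ℝ G y u w v) (v w : E) :
    covDifferential G X y v w - covDifferential G X y w v =
      fderiv ℝ (fun z => G z (X z)) y v w - fderiv ℝ (fun z => G z (X z)) y w v := by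
  rw [fderiv_lower_apply hG hX, fderiv_lower_apply hG hX, covDifferential, covDifferential,
    hsymm v w (X y)]
  ring

/-- The symmetric part of the covariant differential is the Lie derivative of the metric. -/
lemma covDifferential_add_swap {G : E → E →L[ℝ] E →L[ℝ] ℝ} {X : E → E} {y : E}
    (hsymm : ∀ v w u, fderiv ℝ G y u v w = fderiv ℝ G y u w v)
    (hGs : ∀ v w, G y v w = G y w v) (v w : E) :
    covDifferential G X y v w + covDifferential G X y w v =
      fderiv ℝ G y (X y) v w + G y (fderiv ℝ X y v) w + G y v (fderiv ℝ X y w) := by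
  rw [covDifferential, covDifferential, hsymm w v (X y), hGs v]
  ring

lemma fderiv_symm_of_eventually {G : E → E →L[ℝ] E →L[ℝ] ℝ} {y : E}
    (hG : DifferentiableAt ℝ G y) (hs : ∀ᶠ z in nhds y, ∀ v w, G z v w = G z w v) (v w u : E) :
    fderiv ℝ G y u v w = fderiv ℝ G y u w v := by
  have h : ∀ v w : E, fderiv ℝ (fun z => G z v w) y u = fderiv ℝ G y u v w := fun v w => by
    rw [((hG.hasFDerivAt.clm_apply (hasFDerivAt_const v y)).clm_apply
      (hasFDerivAt_const w y)).fderiv]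
    simp
  rw [← h, ← h, Filter.EventuallyEq.fderiv_eq (hs.mono fun z hz => hz v w)]

end CovariantDifferential

/-! ### Coordinates adapted to a torse-forming field -/

section Adapted

variable {E F : Type u} [NormedAddCommGroup E] [NormedSpace ℝ E]
  [NormedAddCommGroup F] [InnerProductSpace ℝ F]

/-- The local coordinate expression of a torse-forming time-like unit vector field: `X` is one,
with scalar `φ`, for the field of bilinear forms `G` on the open set `V`. The signature of `G`
enters through the positivity of `G` on the orthogonal complement of `X`. -/
structure IsLocalTorseForming (V : Set E) (G : E → E →L[ℝ] E →L[ℝ] ℝ) (X : E → E)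
    (φ : E → ℝ) : Prop where
  isOpen : IsOpen V
  contDiffOn_metric : ContDiffOn ℝ ∞ G V
  contDiffOn_field : ContDiffOn ℝ ∞ X V
  symm : ∀ y ∈ V, ∀ v w, G y v w = G y w v
  unit : ∀ y ∈ V, G y (X y) (X y) = -1
  pos : ∀ y ∈ V, ∀ v, G y (X y) v = 0 → v ≠ 0 → 0 < G y v v
  torse : ∀ y ∈ V, ∀ v w,
    covDifferential G X y v w = φ y * (G y (X y) v * G y (X y) w + G y v w)

namespace IsLocalTorseForming

variable {V : Set E} {G : E → E →L[ℝ] E →L[ℝ] ℝ} {X : E → E} {φ : E → ℝ}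

lemma differentiableAt_metric (h : IsLocalTorseForming V G X φ) {y : E} (hy : y ∈ V) :
    DifferentiableAt ℝ G y :=
  (h.contDiffOn_metric.contDiffAt (h.isOpen.mem_nhds hy)).differentiableAt (by simp)

lemma differentiableAt_field (h : IsLocalTorseForming V G X φ) {y : E} (hy : y ∈ V) :
    DifferentiableAt ℝ X y :=
  (h.contDiffOn_field.contDiffAt (h.isOpen.mem_nhds hy)).differentiableAt (by simp)

lemma fderiv_symm (h : IsLocalTorseForming V G X φ) {y : E} (hy : y ∈ V) (v w u : E) :
    fderiv ℝ G y u v w = fderiv ℝ G y u w v :=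
  fderiv_symm_of_eventually (h.differentiableAt_metric hy)
    (by filter_upwards [h.isOpen.mem_nhds hy] with z hz using h.symm z hz) v w u

/-- The one-form dual to a torse-forming field is closed. -/
lemma closed (h : IsLocalTorseForming V G X φ) {y : E} (hy : y ∈ V) (v w : E) :
    fderiv ℝ (fun z => G z (X z)) y v w = fderiv ℝ (fun z => G z (X z)) y w v := by
  have h1 := covDifferential_sub_swap (h.differentiableAt_metric hy) (h.differentiableAt_field hy)
    (h.fderiv_symm hy) v w
  rw [h.torse y hy, h.torse y hy, h.symm y hy v w] at h1
  linarith

/-- The Lie derivative of the metric along a torse-forming field. -/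
lemma lieDerivative (h : IsLocalTorseForming V G X φ) {y : E} (hy : y ∈ V) (v w : E) :
    fderiv ℝ G y (X y) v w + G y (fderiv ℝ X y v) w + G y v (fderiv ℝ X y w) =
      2 * φ y * (G y (X y) v * G y (X y) w + G y v w) := by
  rw [← covDifferential_add_swap (h.fderiv_symm hy) (h.symm y hy), h.torse y hy, h.torse y hy,
    h.symm y hy w v]
  ring

/-- The one-form dual to a torse-forming field is locally exact, by the Poincaré lemma. -/
lemma exists_time (h : IsLocalTorseForming V G X φ) {y₀ : E} (hy₀ : y₀ ∈ V) :
    ∃ (τ : E → ℝ) (W : Set E), IsOpen W ∧ y₀ ∈ W ∧ W ⊆ V ∧ τ y₀ = 0 ∧ ContDiffOn ℝ ∞ τ W ∧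
      ∀ y ∈ W, HasFDerivAt τ (-G y (X y)) y := by
  obtain ⟨r, hr, hrV⟩ := Metric.isOpen_iff.1 h.isOpen y₀ hy₀
  have hα : ContDiffOn ℝ ∞ (fun z => G z (X z)) (Metric.ball y₀ r) :=
    (h.contDiffOn_metric.clm_apply h.contDiffOn_field).mono hrV
  obtain ⟨f, hf⟩ := (convex_ball y₀ r).exists_forall_hasFDerivAt_of_fderiv_symmetric
    Metric.isOpen_ball (hα.differentiableOn (by simp)) (fun a ha v w => h.closed (hrV ha) v w)
  have hτ : ∀ y ∈ Metric.ball y₀ r, HasFDerivAt (fun y => f y₀ - f y) (-G y (X y)) y :=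
    fun y hy => (hf y hy).const_sub (f y₀)
  refine ⟨fun y => f y₀ - f y, Metric.ball y₀ r, Metric.isOpen_ball, Metric.mem_ball_self hr,
    hrV, sub_self _, ?_, hτ⟩
  rw [contDiffOn_infty_iff_fderiv_of_isOpen Metric.isOpen_ball]
  refine ⟨fun y hy => (hτ y hy).differentiableAt.differentiableWithinAt, ?_⟩
  exact hα.neg.congr fun y hy => (hτ y hy).fderiv

variable [FiniteDimensional ℝ E] [FiniteDimensional ℝ F]

/-- Around every point there are coordinates `(t, x)`, onto the product of an interval and a
vector space, with `dt = -X♭` and `dx(X) = 0`. -/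
lemma exists_coordinates (h : IsLocalTorseForming V G X φ)
    (hdim : Module.finrank ℝ E = Module.finrank ℝ F + 1) {y₀ : E} (hy₀ : y₀ ∈ V) :
    ∃ (ψ : OpenPartialHomeomorph E (ℝ × F)) (ε : ℝ), 0 < ε ∧ y₀ ∈ ψ.source ∧ ψ.source ⊆ V ∧
      ψ.target = Ioo (-ε) ε ×ˢ univ ∧ ContDiffOn ℝ ∞ ψ ψ.source ∧
      ContDiffOn ℝ ∞ ψ.symm ψ.target ∧
      ∀ y ∈ ψ.source, (∀ v, (fderiv ℝ ψ y v).1 = -G y (X y) v) ∧ (fderiv ℝ ψ y (X y)).2 = 0 := by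
  have : CompleteSpace E := FiniteDimensional.complete ℝ E
  obtain ⟨τ, W₁, hW₁, hy₁, hWV₁, hτ0, hτ, hτ'⟩ := h.exists_time hy₀
  have hne : X y₀ ≠ 0 := fun h0 => by
    have := h.unit y₀ hy₀
    simp [h0] at this
  obtain ⟨x, W, hW, hyW, hWW₁, hx, hxX, hker⟩ := exists_first_integrals (F := F) hdim hW₁
    (h.contDiffOn_field.mono hWV₁) hy₁ hne
  have hdx : ∀ y ∈ W, HasFDerivAt x (fderiv ℝ x y) y := fun y hy =>
    ((hx.contDiffAt (hW.mem_nhds hy)).differentiableAt (by simp)).hasFDerivAt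
  have hd : ∀ y ∈ W, HasFDerivAt (fun y => (τ y, x y)) ((-G y (X y)).prod (fderiv ℝ x y)) y :=
    fun y hy => (hτ' y (hWW₁ hy)).prodMk (hdx y hy)
  -- a vector in the kernel of `dx` is a multiple of `X`, and `dτ(X) = 1`
  set D : E →L[ℝ] ℝ × F := (-G y₀ (X y₀)).prod (fderiv ℝ x y₀) with hD
  have hinj : Function.Injective (D : E →ₗ[ℝ] ℝ × F) := by
    refine (injective_iff_map_eq_zero _).2 fun v hv => ?_
    have hv1 : -G y₀ (X y₀) v = 0 := congrArg Prod.fst hv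
    have hv2 : fderiv ℝ x y₀ v = 0 := congrArg Prod.snd hv
    obtain ⟨c, rfl⟩ := hker v hv2
    rw [map_smul, h.unit y₀ hy₀] at hv1
    have : c = 0 := by simpa using hv1
    rw [this, zero_smul]
  let D' : E ≃L[ℝ] ℝ × F := (LinearMap.linearEquivOfInjective (D : E →ₗ[ℝ] ℝ × F) hinj (by
    rw [hdim, Module.finrank_prod, Module.finrank_self, add_comm])).toContinuousLinearEquiv
  have hD' : (D' : E →L[ℝ] ℝ × F) = D := by ext v <;> rfl
  obtain ⟨χ, hχ, hyχ, hχW, hsymm⟩ := exists_openPartialHomeomorph_of_contDiffOn hW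
    ((hτ.mono hWW₁).prodMk hx) hyW (f' := D') (by rw [hD']; exact hd y₀ hyW)
  have hχy : χ y₀ = (0, x y₀) := by
    simp only [hχ, hτ0]
  obtain ⟨ε, hε, hεt⟩ := Metric.isOpen_iff.1 χ.open_target (0, x y₀) (hχy ▸ χ.map_source hyχ)
  rw [← ball_prod_same, Real.ball_eq_Ioo, zero_sub, zero_add] at hεt
  -- the second factor of a box in the target is a ball, which is diffeomorphic to `F`
  let κ : OpenPartialHomeomorph (ℝ × F) (ℝ × F) :=
    (OpenPartialHomeomorph.ofSet (Ioo (-ε) ε) isOpen_Ioo).prod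
      (OpenPartialHomeomorph.univBall (x y₀) ε).symm
  have hκs : κ.source = Ioo (-ε) ε ×ˢ Metric.ball (x y₀) ε := by
    simp [κ, OpenPartialHomeomorph.univBall_target _ hε]
  have hκt : κ.target = Ioo (-ε) ε ×ˢ univ := by simp [κ]
  have hκ : ContDiffOn ℝ ∞ κ κ.source := by
    rw [hκs]
    exact contDiff_fst.contDiffOn.prodMk
      (OpenPartialHomeomorph.contDiffOn_univBall_symm.comp contDiff_snd.contDiffOn fun p hp => hp.2)
  have hκsymm : ContDiff ℝ ∞ κ.symm :=
    contDiff_fst.prodMk (OpenPartialHomeomorph.contDiff_univBall.comp contDiff_snd)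
  have hχs : ContDiffOn ℝ ∞ χ χ.source := by
    rw [hχ]
    exact ((hτ.mono hWW₁).prodMk hx).mono hχW
  have htarget : (χ ≫ₕ κ).target = Ioo (-ε) ε ×ˢ univ := by
    rw [OpenPartialHomeomorph.trans_target, ← hκt, inter_eq_left]
    intro p hp
    exact hεt (hκs ▸ κ.map_target hp)
  refine ⟨χ ≫ₕ κ, ε, hε, ?_, ?_, htarget, ?_, ?_, ?_⟩
  · rw [OpenPartialHomeomorph.trans_source]
    refine ⟨hyχ, ?_⟩
    rw [mem_preimage, hχy, hκs]
    exact ⟨⟨by linarith, hε⟩, Metric.mem_ball_self hε⟩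
  · rw [OpenPartialHomeomorph.trans_source]
    exact fun y hy => hWV₁ (hWW₁ (hχW hy.1))
  · rw [OpenPartialHomeomorph.trans_source]
    exact hκ.comp (hχs.mono inter_subset_left) fun y hy => hy.2
  · rw [htarget]
    refine hsymm.comp hκsymm.contDiffOn fun p hp => hεt (hκs ▸ κ.map_target (hκt ▸ hp))
  · intro y hy
    rw [OpenPartialHomeomorph.trans_source] at hy
    have hyW := hχW hy.1
    have hxb : x y ∈ Metric.ball (x y₀) ε := by
      have h1 : χ y ∈ κ.source := hy.2
      rw [hκs, hχ] at h1
      exact h1.2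
    have hσ : DifferentiableAt ℝ (OpenPartialHomeomorph.univBall (x y₀) ε).symm (x y) :=
      ((OpenPartialHomeomorph.contDiffOn_univBall_symm (n := ⊤)).contDiffAt
        (Metric.isOpen_ball.mem_nhds hxb)).differentiableAt (by simp)
    have h1 : HasFDerivAt (χ ≫ₕ κ) ((-G y (X y)).prod
        ((fderiv ℝ (OpenPartialHomeomorph.univBall (x y₀) ε).symm (x y)).comp
          (fderiv ℝ x y))) y := by
      have h2 : ((χ ≫ₕ κ : OpenPartialHomeomorph E (ℝ × F)) : E → ℝ × F) =
          fun y => (τ y, (OpenPartialHomeomorph.univBall (x y₀) ε).symm (x y)) := by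
        funext y
        rw [OpenPartialHomeomorph.coe_trans, Function.comp, hχ]
        rfl
      rw [h2]
      exact (hτ' y (hWW₁ hyW)).prodMk (hσ.hasFDerivAt.comp y (hdx y hyW))
    rw [h1.fderiv]
    exact ⟨fun v => rfl, by simp [hxX y hyW]⟩

end IsLocalTorseForming

end Adapted

/-! ### The twisted product form of the metric in adapted coordinates -/

lemma hasDerivAt_comp_curve {E Z : Type*} [NormedAddCommGroup E] [NormedSpace ℝ E]
    [NormedAddCommGroup Z] [NormedSpace ℝ Z] {g : E → Z} {c : ℝ → E} {c' a : E} {t : ℝ}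
    (hg : DifferentiableAt ℝ g a) (hc : HasDerivAt c c' t) (ha : c t = a) :
    HasDerivAt (fun s => g (c s)) (fderiv ℝ g a c') t :=
  HasFDerivAt.comp_hasDerivAt_of_eq t hg.hasFDerivAt hc ha.symm

section TwistedForm

variable {E F : Type u} [NormedAddCommGroup E] [NormedSpace ℝ E]
  [NormedAddCommGroup F] [InnerProductSpace ℝ F]

/-- The bilinear form on `F` obtained by pulling `G` back along `z ↦ β (t, z)`. -/
def slicePullback (G : E → E →L[ℝ] E →L[ℝ] ℝ) (β : ℝ × F → E) (p : ℝ × F) : F →L[ℝ] F →L[ℝ] ℝ :=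
  (G (β p)).bilinearComp ((fderiv ℝ β p).comp (ContinuousLinearMap.inr ℝ ℝ F))
    ((fderiv ℝ β p).comp (ContinuousLinearMap.inr ℝ ℝ F))

@[simp] lemma slicePullback_apply (G : E → E →L[ℝ] E →L[ℝ] ℝ) (β : ℝ × F → E) (p : ℝ × F)
    (v w : F) : slicePullback G β p v w = G (β p) (fderiv ℝ β p (0, v)) (fderiv ℝ β p (0, w)) := by
  simp [slicePullback]

lemma contDiffOn_slicePullback [FiniteDimensional ℝ F] {G : E → E →L[ℝ] E →L[ℝ] ℝ}
    {β : ℝ × F → E} {V : Set E} {O : Set (ℝ × F)} (hO : IsOpen O) (hG : ContDiffOn ℝ ∞ G V)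
    (hβ : ContDiffOn ℝ ∞ β O) (hOV : MapsTo β O V) : ContDiffOn ℝ ∞ (slicePullback G β) O := by
  refine contDiffOn_clm_apply.2 fun v => contDiffOn_clm_apply.2 fun w => ?_
  simp only [slicePullback_apply]
  have h1 : ContDiffOn ℝ ∞ (fderiv ℝ β) O := hβ.fderiv_of_isOpen hO (by simp)
  exact ((hG.comp hβ hOV).clm_apply (h1.clm_apply contDiffOn_const)).clm_apply
    (h1.clm_apply contDiffOn_const)

namespace IsLocalTorseForming

variable {V : Set E} {G : E → E →L[ℝ] E →L[ℝ] ℝ} {X : E → E} {φ : E → ℝ}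

/-- In coordinates in which `X = ∂ₜ`, the slice metric obeys `∂ₜ h = 2 φ h`. -/
lemma hasDerivAt_slicePullback (h : IsLocalTorseForming V G X φ) {β : ℝ × F → E}
    {O : Set (ℝ × F)} (hO : IsOpen O) (hβ : ContDiffOn ℝ ∞ β O) (hOV : MapsTo β O V)
    (hX : ∀ p ∈ O, fderiv ℝ β p (1, 0) = X (β p))
    (hperp : ∀ p ∈ O, ∀ v, G (β p) (X (β p)) (fderiv ℝ β p (0, v)) = 0)
    {p : ℝ × F} (hp : p ∈ O) (v w : F) :
    HasDerivAt (fun s => slicePullback G β (s, p.2) v w)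
      (2 * φ (β p) * slicePullback G β p v w) p.1 := by
  have hmin : minSmoothness ℝ 2 ≤ ∞ := by simpa using (by norm_cast : (2 : ℕ∞ω) ≤ ∞)
  have hβp : ContDiffAt ℝ ∞ β p := hβ.contDiffAt (hO.mem_nhds hp)
  have hdβ : DifferentiableAt ℝ (fderiv ℝ β) p :=
    (((hβ.fderiv_of_isOpen hO (m := ∞) (by simp))).contDiffAt (hO.mem_nhds hp)).differentiableAt
      (by simp)
  have hline : HasDerivAt (fun s : ℝ => (s, p.2)) ((1, 0) : ℝ × F) p.1 :=
    (hasDerivAt_id _).prodMk (hasDerivAt_const _ _)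
  have hb : HasDerivAt (fun s => β (s, p.2)) (X (β p)) p.1 := by
    rw [← hX p hp]
    exact hasDerivAt_comp_curve (hβp.differentiableAt (by simp)) hline rfl
  have hG : HasDerivAt (fun s => G (β (s, p.2))) (fderiv ℝ G (β p) (X (β p))) p.1 :=
    hasDerivAt_comp_curve (Z := E →L[ℝ] E →L[ℝ] ℝ) (h.differentiableAt_metric (hOV hp)) hb rfl
  -- the mixed second derivatives of `β` agree, so `∂ₜ ∂ᵥ β = ∂ᵥ (X ∘ β)`
  have hv : ∀ v : F, HasDerivAt (fun s => fderiv ℝ β (s, p.2) (0, v))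
      (fderiv ℝ X (β p) (fderiv ℝ β p (0, v))) p.1 := by
    intro v
    have h1 : HasDerivAt (fun s => fderiv ℝ β (s, p.2)) (fderiv ℝ (fderiv ℝ β) p (1, 0)) p.1 :=
      hasDerivAt_comp_curve (Z := ℝ × F →L[ℝ] E) hdβ hline rfl
    have h2 := h1.clm_apply (hasDerivAt_const p.1 ((0, v) : ℝ × F))
    rw [map_zero, add_zero, (hβp.isSymmSndFDerivAt hmin).eq (1, 0) (0, v)] at h2
    convert! h2 using 1
    have h3 : HasFDerivAt (fun q => fderiv ℝ β q (1, 0))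
        ((fderiv ℝ X (β p)).comp (fderiv ℝ β p)) p :=
      ((h.differentiableAt_field (hOV hp)).hasFDerivAt.comp p
        (hβp.differentiableAt (by simp)).hasFDerivAt).congr_of_eventuallyEq
        (by filter_upwards [hO.mem_nhds hp] with q hq using hX q hq)
    have h4 := (hdβ.hasFDerivAt.clm_apply (hasFDerivAt_const ((1, 0) : ℝ × F) p)).unique h3
    have h5 := congrArg (fun L : ℝ × F →L[ℝ] E => L (0, v)) h4
    simpa using h5.symm
  have hall := (hG.clm_apply (hv v)).clm_apply (hv w)
  simp only [slicePullback_apply]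
  convert! hall using 1
  have hL := h.lieDerivative (hOV hp) (fderiv ℝ β p (0, v)) (fderiv ℝ β p (0, w))
  rw [hperp p hp, zero_mul, zero_add] at hL
  rw [← hL]
  simp

variable [FiniteDimensional ℝ E] [FiniteDimensional ℝ F]

/-- Around every point there are coordinates `(t, x)` in which
`G = -dt² + f(t, x)² H(x)(dx, dx)`. The solution of `∂ₜ h = 2 φ h` is a positive multiple of its
value at `t = 0`, and the multiple is the ratio of the values of the two forms on one vector. -/
theorem exists_twisted_coordinates (h : IsLocalTorseForming V G X φ)
    (hdim : Module.finrank ℝ E = Module.finrank ℝ F + 1) {y₀ : E} (hy₀ : y₀ ∈ V) :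
    ∃ (ψ : OpenPartialHomeomorph E (ℝ × F)) (ε : ℝ) (H : F → F →L[ℝ] F →L[ℝ] ℝ) (f : ℝ × F → ℝ),
      0 < ε ∧ y₀ ∈ ψ.source ∧ ψ.source ⊆ V ∧
      ψ.target = Ioo (-ε) ε ×ˢ univ ∧ ContDiffOn ℝ ∞ ψ ψ.source ∧
      ContDiffOn ℝ ∞ ψ.symm ψ.target ∧ ContDiff ℝ ∞ H ∧ (∀ z v w, H z v w = H z w v) ∧
      (∀ z v, v ≠ 0 → 0 < H z v v) ∧ ContDiffOn ℝ ∞ f ψ.target ∧ (∀ p ∈ ψ.target, 0 < f p) ∧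
      ∀ y ∈ ψ.source, ∀ v w, G y v w = -((fderiv ℝ ψ y v).1 * (fderiv ℝ ψ y w).1) +
        f (ψ y) ^ 2 * H (ψ y).2 (fderiv ℝ ψ y v).2 (fderiv ℝ ψ y w).2 := by
  obtain ⟨ψ, ε, hε, hyψ, hψV, hψt, hψ, hψsymm, hψd⟩ := h.exists_coordinates (F := F) hdim hy₀
  set β := ψ.symm with hβ
  have hO := ψ.open_target
  have hOV : MapsTo β ψ.target V := fun p hp => hψV (ψ.map_target hp)
  have hdψ : ∀ y ∈ ψ.source, DifferentiableAt ℝ ψ y := fun y hy =>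
    (hψ.contDiffAt (ψ.open_source.mem_nhds hy)).differentiableAt (by simp)
  have hdβ : ∀ p ∈ ψ.target, DifferentiableAt ℝ β p := fun p hp =>
    (hψsymm.contDiffAt (hO.mem_nhds hp)).differentiableAt (by simp)
  have hβψ : ∀ p ∈ ψ.target, ∀ v, fderiv ℝ β p (fderiv ℝ ψ (β p) v) = v := by
    intro p hp v
    have hy := ψ.map_target hp
    have h1 := HasFDerivAt.comp (β p) (by rw [ψ.right_inv hp]; exact (hdβ p hp).hasFDerivAt)
      (hdψ _ hy).hasFDerivAt
    have h2 : HasFDerivAt (β ∘ ψ) (ContinuousLinearMap.id ℝ E) (β p) :=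
      (hasFDerivAt_id _).congr_of_eventuallyEq (ψ.eventually_left_inverse hy)
    exact congrArg (fun L : E →L[ℝ] E => L v) (h1.unique h2)
  have hψβ : ∀ p ∈ ψ.target, ∀ q, fderiv ℝ ψ (β p) (fderiv ℝ β p q) = q := by
    intro p hp q
    have h1 := HasFDerivAt.comp p (hdψ _ (ψ.map_target hp)).hasFDerivAt (hdβ p hp).hasFDerivAt
    have h2 : HasFDerivAt (ψ ∘ β) (ContinuousLinearMap.id ℝ _) p :=
      (hasFDerivAt_id _).congr_of_eventuallyEq (ψ.eventually_right_inverse hp)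
    exact congrArg (fun L : ℝ × F →L[ℝ] ℝ × F => L q) (h1.unique h2)
  have hX : ∀ p ∈ ψ.target, fderiv ℝ β p (1, 0) = X (β p) := by
    intro p hp
    have hy := ψ.map_target hp
    have h1 : fderiv ℝ ψ (β p) (X (β p)) = (1, 0) := by
      refine Prod.ext ?_ (hψd _ hy).2
      rw [(hψd _ hy).1, h.unit _ (hψV hy), neg_neg]
    rw [← h1, hβψ p hp]
  have hperp : ∀ p ∈ ψ.target, ∀ v, G (β p) (X (β p)) (fderiv ℝ β p (0, v)) = 0 := by
    intro p hp v
    have h1 := (hψd _ (ψ.map_target hp)).1 (fderiv ℝ β p (0, v))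
    rw [hψβ p hp] at h1
    linarith
  set k := slicePullback G β with hk
  have hkc : ContDiffOn ℝ ∞ k ψ.target :=
    contDiffOn_slicePullback hO h.contDiffOn_metric hψsymm hOV
  have hkd : ∀ p ∈ ψ.target, ∀ v w,
      HasDerivAt (fun s => k (s, p.2) v w) (2 * φ (β p) * k p v w) p.1 :=
    fun p hp v w => h.hasDerivAt_slicePullback hO hψsymm hOV hX hperp hp v w
  have hksymm : ∀ p ∈ ψ.target, ∀ v w, k p v w = k p w v := fun p hp v w => by
    rw [hk, slicePullback_apply, slicePullback_apply, h.symm _ (hOV hp)]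
  have hkpos : ∀ p ∈ ψ.target, ∀ v, v ≠ 0 → 0 < k p v v := fun p hp v hv => by
    rw [hk, slicePullback_apply]
    refine h.pos _ (hOV hp) _ (hperp p hp v) fun h0 => hv ?_
    have h1 := hψβ p hp (0, v)
    rw [h0, map_zero] at h1
    exact (congrArg Prod.snd h1).symm
  have hform : ∀ y ∈ ψ.source, ∀ v w, G y v w =
      -((fderiv ℝ ψ y v).1 * (fderiv ℝ ψ y w).1) +
        k (ψ y) (fderiv ℝ ψ y v).2 (fderiv ℝ ψ y w).2 := by
    intro y hy v w
    have hp := ψ.map_source hy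
    have hβy : β (ψ y) = y := ψ.left_inv hy
    have hdec : ∀ v, v = (fderiv ℝ ψ y v).1 • X y + fderiv ℝ β (ψ y) (0, (fderiv ℝ ψ y v).2) := by
      intro v
      have h1 := hβψ _ hp v
      have h2 := hX _ hp
      rw [hβy] at h1 h2
      rw [← h2, ← map_smul, ← map_add]
      conv_lhs => rw [← h1]
      congr 1
      ext <;> simp
    have hp1 := hperp _ hp
    rw [hβy] at hp1
    rw [hk, slicePullback_apply, hβy]
    conv_lhs => rw [hdec v, hdec w]
    simp only [map_add, map_smul, add_apply, smul_apply,
      smul_eq_mul, h.unit y (hψV hy), hp1, h.symm y (hψV hy) (fderiv ℝ β (ψ y) _) (X y)]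
    ring
  have hmem : ∀ t ∈ Ioo (-ε) ε, ∀ z, ((t, z) : ℝ × F) ∈ ψ.target := fun t ht z => by
    rw [hψt]; exact ⟨ht, mem_univ z⟩
  have h0I : (0 : ℝ) ∈ Ioo (-ε) ε := ⟨by linarith, hε⟩
  have hHc : ContDiff ℝ ∞ fun z => k (0, z) := by
    rw [← contDiffOn_univ]
    exact hkc.comp (contDiff_const.prodMk contDiff_id).contDiffOn fun z _ => hmem 0 h0I z
  -- with no spatial direction the ratio below is `0 / 0`, and any positive function serves
  rcases subsingleton_or_nontrivial F with hF | hF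
  · refine ⟨ψ, ε, fun z => k (0, z), fun _ => 1, hε, hyψ, hψV, hψt, hψ, hψsymm, hHc,
      fun z => hksymm _ (hmem 0 h0I z), fun z => hkpos _ (hmem 0 h0I z), contDiffOn_const,
      fun _ _ => one_pos, fun y hy v w => ?_⟩
    rw [hform y hy, Subsingleton.elim (fderiv ℝ ψ y v).2 0]
    simp
  obtain ⟨v₀, hv₀⟩ := exists_ne (0 : F)
  have hconst : ∀ t ∈ Ioo (-ε) ε, ∀ z v w,
      k (t, z) v w = k (t, z) v₀ v₀ / k (0, z) v₀ v₀ * k (0, z) v w := by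
    intro t ht z v w
    have hpos : ∀ s ∈ Ioo (-ε) ε, k (s, z) v₀ v₀ ≠ 0 := fun s hs =>
      (hkpos _ (hmem s hs z) v₀ hv₀).ne'
    have hder : ∀ s ∈ Ioo (-ε) ε,
        HasDerivAt (fun s => k (s, z) v w / k (s, z) v₀ v₀) 0 s := by
      intro s hs
      have h1 := (hkd _ (hmem s hs z) v w).div (hkd _ (hmem s hs z) v₀ v₀) (hpos s hs)
      convert! h1 using 1
      simp only
      ring
    have h2 : k (t, z) v w / k (t, z) v₀ v₀ = k (0, z) v w / k (0, z) v₀ v₀ :=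
      isOpen_Ioo.is_const_of_deriv_eq_zero (f := fun s => k (s, z) v w / k (s, z) v₀ v₀)
        isPreconnected_Ioo
        (fun s hs => (hder s hs).differentiableAt.differentiableWithinAt)
        (fun s hs => (hder s hs).deriv) ht h0I
    have h3 := hpos t ht
    have h4 := hpos 0 h0I
    field_simp at h2 ⊢
    linarith
  have hratio : ∀ p ∈ ψ.target, 0 < k p v₀ v₀ / k (0, p.2) v₀ v₀ := fun p hp =>
    div_pos (hkpos p hp v₀ hv₀) (hkpos _ (hmem 0 h0I p.2) v₀ hv₀)
  refine ⟨ψ, ε, fun z => k (0, z), fun p => √(k p v₀ v₀ / k (0, p.2) v₀ v₀), hε, hyψ, hψV, hψt,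
    hψ, hψsymm, hHc, fun z => hksymm _ (hmem 0 h0I z), fun z => hkpos _ (hmem 0 h0I z), ?_,
    fun p hp => Real.sqrt_pos.2 (hratio p hp), fun y hy v w => ?_⟩
  · refine ContDiffOn.sqrt (ContDiffOn.div ?_ ?_ fun p _ => ?_) fun p hp => (hratio p hp).ne'
    · exact (hkc.clm_apply contDiffOn_const).clm_apply contDiffOn_const
    · exact (((hHc.comp contDiff_snd).clm_apply contDiff_const).clm_apply contDiff_const).contDiffOn
    · exact (hkpos _ (hmem 0 h0I p.2) v₀ hv₀).ne'
  · have hp := ψ.map_source hy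
    rw [hform y hy, Real.sq_sqrt (hratio _ hp).le]
    have ht : (ψ y).1 ∈ Ioo (-ε) ε := by rw [hψt] at hp; exact hp.1
    rw [← hconst _ ht (ψ y).2]

end IsLocalTorseForming

end TwistedForm

/-! ### The covariant differential in twisted coordinates -/

section Converse

variable {E F : Type*} [NormedAddCommGroup E] [NormedSpace ℝ E]
  [NormedAddCommGroup F] [NormedSpace ℝ F]

/-- If `G = -dτ² + f² H(x)(dx, dx)` near a point, with `dτ(X) = 1` and `dx(X) = 0`, then `X` is
torse-forming with scalar `X(f) / f`. -/
theorem covDifferential_of_twisted {G : E → E →L[ℝ] E →L[ℝ] ℝ} {X : E → E} {τ f : E → ℝ}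
    {x : E → F} {H : F → F →L[ℝ] F →L[ℝ] ℝ} {y : E}
    (hG : DifferentiableAt ℝ G y) (hX : DifferentiableAt ℝ X y) (hτ : ContDiffAt ℝ ∞ τ y)
    (hx : ContDiffAt ℝ ∞ x y) (hf : DifferentiableAt ℝ f y) (hf0 : f y ≠ 0)
    (hH : DifferentiableAt ℝ H (x y)) (hsymm : ∀ᶠ z in nhds y, ∀ v w, G z v w = G z w v)
    (hform : ∀ᶠ z in nhds y, ∀ v w, G z v w = -(fderiv ℝ τ z v * fderiv ℝ τ z w) +
      f z ^ 2 * H (x z) (fderiv ℝ x z v) (fderiv ℝ x z w))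
    (hτX : ∀ᶠ z in nhds y, fderiv ℝ τ z (X z) = 1)
    (hxX : ∀ᶠ z in nhds y, fderiv ℝ x z (X z) = 0) (v w : E) :
    covDifferential G X y v w =
      fderiv ℝ f y (X y) / f y * (G y (X y) v * G y (X y) w + G y v w) := by
  have hmin : minSmoothness ℝ 2 ≤ ∞ := by simpa using (by norm_cast : (2 : ℕ∞ω) ≤ ∞)
  have hdτ : DifferentiableAt ℝ (fderiv ℝ τ) y :=
    (hτ.fderiv_right (m := 1) (by norm_cast)).differentiableAt (by simp)
  have hdx : DifferentiableAt ℝ (fderiv ℝ x) y :=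
    (hx.fderiv_right (m := 1) (by norm_cast)).differentiableAt (by simp)
  have hα : ∀ᶠ z in nhds y, G z (X z) = -fderiv ℝ τ z := by
    filter_upwards [hform, hτX, hxX] with z h1 h2 h3
    ext v
    simp [h1, h2, h3]
  have hαy : ∀ v, G y (X y) v = -fderiv ℝ τ y v := fun v => by rw [hα.self_of_nhds]; rfl
  have hGs := fderiv_symm_of_eventually hG hsymm
  have hclosed : covDifferential G X y v w - covDifferential G X y w v = 0 := by
    rw [covDifferential_sub_swap hG hX hGs, Filter.EventuallyEq.fderiv_eq hα]
    have h1 : fderiv ℝ (fun z => -fderiv ℝ τ z) y = -fderiv ℝ (fderiv ℝ τ) y := fderiv_neg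
    rw [h1]
    simp only [neg_apply]
    rw [(hτ.isSymmSndFDerivAt hmin).eq v w, sub_self]
  -- differentiating `dτ(X) = 1` and `dx(X) = 0`
  have hτ2 : ∀ v, fderiv ℝ (fderiv ℝ τ) y (X y) v = -fderiv ℝ τ y (fderiv ℝ X y v) := by
    intro v
    have h1 := (hdτ.hasFDerivAt.clm_apply hX.hasFDerivAt).unique
      ((hasFDerivAt_const (1 : ℝ) y).congr_of_eventuallyEq hτX)
    have h2 := congrArg (fun L : E →L[ℝ] ℝ => L v) h1
    simp only [add_apply, ContinuousLinearMap.comp_apply,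
      ContinuousLinearMap.flip_apply, zero_apply] at h2
    rw [(hτ.isSymmSndFDerivAt hmin).eq (X y) v]
    linarith
  have hx2 : ∀ v, fderiv ℝ (fderiv ℝ x) y (X y) v = -fderiv ℝ x y (fderiv ℝ X y v) := by
    intro v
    have h1 := (hdx.hasFDerivAt.clm_apply hX.hasFDerivAt).unique
      ((hasFDerivAt_const (0 : F) y).congr_of_eventuallyEq hxX)
    have h2 := congrArg (fun L : E →L[ℝ] F => L v) h1
    simp only [add_apply, ContinuousLinearMap.comp_apply,
      ContinuousLinearMap.flip_apply, zero_apply] at h2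
    rw [(hx.isSymmSndFDerivAt hmin).eq (X y) v]
    exact eq_neg_of_add_eq_zero_right h2
  -- the derivative of the metric along `X`, from its twisted form
  have hDG : fderiv ℝ G y (X y) v w =
      fderiv ℝ τ y (fderiv ℝ X y v) * fderiv ℝ τ y w
        + fderiv ℝ τ y v * fderiv ℝ τ y (fderiv ℝ X y w)
        + 2 * f y * fderiv ℝ f y (X y) * H (x y) (fderiv ℝ x y v) (fderiv ℝ x y w)
        - f y ^ 2 * (H (x y) (fderiv ℝ x y (fderiv ℝ X y v)) (fderiv ℝ x y w)
          + H (x y) (fderiv ℝ x y v) (fderiv ℝ x y (fderiv ℝ X y w))) := by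
    have hline : HasDerivAt (fun s : ℝ => y + s • X y) (X y) 0 := by
      simpa using ((hasDerivAt_id (0 : ℝ)).smul_const (X y)).const_add y
    have hy0 : y = y + (0 : ℝ) • X y := by simp
    have hcont : Filter.Tendsto (fun s : ℝ => y + s • X y) (nhds 0) (nhds y) := by
      have := hline.continuousAt.tendsto
      rwa [← hy0] at this
    have hl : HasDerivAt (fun s : ℝ => G (y + s • X y) v w) (fderiv ℝ G y (X y) v w) 0 := by
      have h1 := hasDerivAt_comp_curve (Z := E →L[ℝ] E →L[ℝ] ℝ) hG hline hy0.symm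
      have h2 := (h1.clm_apply (hasDerivAt_const 0 v)).clm_apply (hasDerivAt_const 0 w)
      simpa using h2
    have hHx : HasDerivAt (fun s : ℝ => H (x (y + s • X y))) 0 0 := by
      have h1 := hasDerivAt_comp_curve (hx.differentiableAt (by simp)) hline hy0.symm
      rw [hxX.self_of_nhds] at h1
      have h2 := hasDerivAt_comp_curve (Z := F →L[ℝ] F →L[ℝ] ℝ) hH h1 (by rw [← hy0])
      rwa [(fderiv ℝ H (x y)).map_zero] at h2
    have hxv : ∀ v, HasDerivAt (fun s : ℝ => fderiv ℝ x (y + s • X y) v)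
        (-fderiv ℝ x y (fderiv ℝ X y v)) 0 := fun v => by
      have := (hasDerivAt_comp_curve (Z := E →L[ℝ] F) hdx hline hy0.symm).clm_apply
        (hasDerivAt_const 0 v)
      rw [map_zero, add_zero, hx2] at this
      exact this
    have hτv : ∀ v, HasDerivAt (fun s : ℝ => fderiv ℝ τ (y + s • X y) v)
        (-fderiv ℝ τ y (fderiv ℝ X y v)) 0 := fun v => by
      have := (hasDerivAt_comp_curve (Z := E →L[ℝ] ℝ) hdτ hline hy0.symm).clm_apply
        (hasDerivAt_const 0 v)
      rw [map_zero, add_zero, hτ2] at this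
      exact this
    have hr := (((hτv v).mul (hτv w)).neg.add (((hasDerivAt_comp_curve hf hline hy0.symm).pow 2).mul
      ((hHx.clm_apply (hxv v)).clm_apply (hxv w))))
    have hr' := hr.congr_of_eventuallyEq
      ((hcont.eventually hform).mono fun s hs => hs v w)
    rw [hl.unique hr']
    simp
    ring
  -- the covariant differential is symmetric, so it is half of the Lie derivative of the metric
  have hlie := covDifferential_add_swap hGs (fun v w => hsymm.self_of_nhds v w) v w (X := X)
  rw [hDG, hform.self_of_nhds, hform.self_of_nhds] at hlie
  rw [hαy, hαy, hform.self_of_nhds]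
  have h2 : 2 * covDifferential G X y v w = 2 * f y * fderiv ℝ f y (X y) *
      H (x y) (fderiv ℝ x y v) (fderiv ℝ x y w) := by
    linear_combination hlie + hclosed
  field_simp
  linear_combination f y * h2 / 2

end Converse

/-! ### Tensor fields read in a chart -/

section ChartExpressions

variable {E : Type*} [NormedAddCommGroup E] [NormedSpace ℝ E]
  {M : Type*} [TopologicalSpace M] [ChartedSpace E M]

/-- The expression in the chart `e` of a field of bilinear forms on the tangent spaces. -/
def chartForm (h : (p : M) → TangentSpace 𝓘(ℝ, E) p →L[ℝ] TangentSpace 𝓘(ℝ, E) p →L[ℝ] ℝ)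
    (e : OpenPartialHomeomorph M E) (y : E) : E →L[ℝ] E →L[ℝ] ℝ :=
  let A : E →L[ℝ] E →L[ℝ] ℝ := h (e.symm y)
  let D : E →L[ℝ] E := mfderiv 𝓘(ℝ, E) 𝓘(ℝ, E) e.symm y
  A.bilinearComp D D

lemma chartForm_apply
    (h : (p : M) → TangentSpace 𝓘(ℝ, E) p →L[ℝ] TangentSpace 𝓘(ℝ, E) p →L[ℝ] ℝ)
    (e : OpenPartialHomeomorph M E) (y v w : E) :
    chartForm h e y v w = h (e.symm y) (mfderiv 𝓘(ℝ, E) 𝓘(ℝ, E) e.symm y v)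
      (mfderiv 𝓘(ℝ, E) 𝓘(ℝ, E) e.symm y w) := rfl

/-- The expression in the chart `e` of a vector field. -/
def chartField (u : (p : M) → TangentSpace 𝓘(ℝ, E) p) (e : OpenPartialHomeomorph M E) (y : E) : E :=
  mfderiv 𝓘(ℝ, E) 𝓘(ℝ, E) e (e.symm y) (u (e.symm y))

variable {e : OpenPartialHomeomorph M E}

lemma mdifferentiable_of_mem_maximalAtlas (he : e ∈ IsManifold.maximalAtlas 𝓘(ℝ, E) ∞ M) :
    e.MDifferentiable 𝓘(ℝ, E) 𝓘(ℝ, E) :=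
  ⟨(contMDiffOn_of_mem_maximalAtlas he).mdifferentiableOn (by simp),
    (contMDiffOn_symm_of_mem_maximalAtlas he).mdifferentiableOn (by simp)⟩

lemma mfderiv_symm_chartField (he : e ∈ IsManifold.maximalAtlas 𝓘(ℝ, E) ∞ M)
    (u : (p : M) → TangentSpace 𝓘(ℝ, E) p) {y : E} (hy : y ∈ e.target) :
    mfderiv 𝓘(ℝ, E) 𝓘(ℝ, E) e.symm y (chartField u e y : E) = u (e.symm y) := by
  have h := (mdifferentiable_of_mem_maximalAtlas he).symm_comp_deriv (e.map_target hy)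
  rw [e.right_inv hy] at h
  exact congrArg (fun L : TangentSpace 𝓘(ℝ, E) (e.symm y) →L[ℝ] _ => L (u (e.symm y))) h

/-- The expression of a field of forms in a chart determines the field. -/
lemma chartForm_mfderiv (h : (p : M) → TangentSpace 𝓘(ℝ, E) p →L[ℝ] TangentSpace 𝓘(ℝ, E) p →L[ℝ] ℝ)
    (he : e ∈ IsManifold.maximalAtlas 𝓘(ℝ, E) ∞ M)
    {q : M} (hq : q ∈ e.source) (v w : TangentSpace 𝓘(ℝ, E) q) :
    chartForm h e (e q) (mfderiv 𝓘(ℝ, E) 𝓘(ℝ, E) e q v : E)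
      (mfderiv 𝓘(ℝ, E) 𝓘(ℝ, E) e q w : E) = h q v w := by
  have h1 : ∀ a : TangentSpace 𝓘(ℝ, E) q, mfderiv 𝓘(ℝ, E) 𝓘(ℝ, E) e.symm (e q)
      (mfderiv 𝓘(ℝ, E) 𝓘(ℝ, E) e q a) = a := fun a =>
    congrArg (fun L : TangentSpace 𝓘(ℝ, E) q →L[ℝ] _ => L a)
      ((mdifferentiable_of_mem_maximalAtlas he).symm_comp_deriv hq)
  have h2 : ∀ (q' : M) (_ : q' = q) (a b : E),
      (h q' : E →L[ℝ] E →L[ℝ] ℝ) a b = (h q : E →L[ℝ] E →L[ℝ] ℝ) a b := by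
    rintro q' rfl a b
    rfl
  exact (h2 _ (e.left_inv hq) _ _).trans (congrArg₂ (fun a b => h q a b) (h1 v) (h1 w))

variable [IsManifold 𝓘(ℝ, E) ∞ M]

/-- The vector field of constant chart expression `v`. -/
lemma contMDiffOn_coordVec (he : e ∈ IsManifold.maximalAtlas 𝓘(ℝ, E) ∞ M) (v : E) :
    ContMDiffOn 𝓘(ℝ, E) 𝓘(ℝ, E).tangent ∞
      (fun y => (⟨e.symm y, mfderiv 𝓘(ℝ, E) 𝓘(ℝ, E) e.symm y v⟩ : TangentBundle 𝓘(ℝ, E) M))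
      e.target := by
  have h1 := (contMDiffOn_symm_of_mem_maximalAtlas he).contMDiffOn_tangentMapWithin (m := ∞)
    (by simp) e.open_target.uniqueMDiffOn
  have h2 : ContMDiffOn 𝓘(ℝ, E) 𝓘(ℝ, E).tangent ∞
      (fun y => (⟨y, v⟩ : TangentBundle 𝓘(ℝ, E) E)) e.target :=
    contMDiffOn_vectorSpace_iff_contDiffOn.2 contDiffOn_const
  refine (h1.comp h2 fun y hy => hy).congr fun y hy => ?_
  simp only [Function.comp, tangentMapWithin]
  rw [mfderivWithin_of_isOpen e.open_target hy]

lemma contDiffOn_chartForm [FiniteDimensional ℝ E]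
    {h : (p : M) → TangentSpace 𝓘(ℝ, E) p →L[ℝ] TangentSpace 𝓘(ℝ, E) p →L[ℝ] ℝ}
    (hh : ContMDiff 𝓘(ℝ, E) (𝓘(ℝ, E).prod 𝓘(ℝ, E →L[ℝ] E →L[ℝ] ℝ)) ∞
      (fun p => Bundle.TotalSpace.mk' (E →L[ℝ] E →L[ℝ] ℝ)
        (E := fun p : M => TangentSpace 𝓘(ℝ, E) p →L[ℝ] TangentSpace 𝓘(ℝ, E) p →L[ℝ] ℝ) p (h p)))
    (he : e ∈ IsManifold.maximalAtlas 𝓘(ℝ, E) ∞ M) :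
    ContDiffOn ℝ ∞ (chartForm h e) e.target := by
  refine contDiffOn_clm_apply.2 fun v => contDiffOn_clm_apply.2 fun w => ?_
  rw [← contMDiffOn_iff_contDiffOn]
  have h1 : ContMDiffOn 𝓘(ℝ, E) (𝓘(ℝ, E).prod 𝓘(ℝ)) ∞
      (fun y => Bundle.TotalSpace.mk' ℝ (E := Bundle.Trivial M ℝ) (e.symm y)
        (h (e.symm y) (mfderiv 𝓘(ℝ, E) 𝓘(ℝ, E) e.symm y v)
          (mfderiv 𝓘(ℝ, E) 𝓘(ℝ, E) e.symm y w))) e.target := by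
    apply ContMDiffOn.clm_bundle_apply₂ (F₁ := E) (F₂ := E)
    · exact hh.comp_contMDiffOn (contMDiffOn_symm_of_mem_maximalAtlas he)
    · exact contMDiffOn_coordVec he v
    · exact contMDiffOn_coordVec he w
  intro y hy
  have h2 := h1 y hy
  simp only [Bundle.contMDiffWithinAt_totalSpace] at h2
  exact h2.2

lemma contDiffOn_chartField (he : e ∈ IsManifold.maximalAtlas 𝓘(ℝ, E) ∞ M) {U : Set M}
    {u : (p : M) → TangentSpace 𝓘(ℝ, E) p}
    (hu : ContMDiffOn 𝓘(ℝ, E) 𝓘(ℝ, E).tangent ∞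
      (fun p => (⟨p, u p⟩ : TangentBundle 𝓘(ℝ, E) M)) U) :
    ContDiffOn ℝ ∞ (chartField u e) (e.target ∩ e.symm ⁻¹' U) := by
  have h1 := (contMDiffOn_of_mem_maximalAtlas he).contMDiffOn_tangentMapWithin (m := ∞)
    (by simp) e.open_source.uniqueMDiffOn
  have h2 : ContMDiffOn 𝓘(ℝ, E) 𝓘(ℝ, E).tangent ∞
      (fun y => (⟨e.symm y, u (e.symm y)⟩ : TangentBundle 𝓘(ℝ, E) M)) (e.target ∩ e.symm ⁻¹' U) :=
    hu.comp ((contMDiffOn_symm_of_mem_maximalAtlas he).mono inter_subset_left) fun y hy => hy.2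
  have h3 := (contMDiff_snd_tangentBundle_modelSpace E 𝓘(ℝ, E) (n := ∞)).comp_contMDiffOn
    (h1.comp h2 fun y hy => e.map_target hy.1)
  rw [← contMDiffOn_iff_contDiffOn]
  refine h3.congr fun y hy => ?_
  simp only [Function.comp, tangentMapWithin]
  rw [mfderivWithin_of_isOpen e.open_source (e.map_target hy.1)]
  rfl

end ChartExpressions

/-! ### Pointwise algebra of Lorentzian forms -/

section Signature

variable {d : ℕ} {E : Type*} [NormedAddCommGroup E] [NormedSpace ℝ E]
  {B : E →L[ℝ] E →L[ℝ] ℝ} {b : Module.Basis (Fin (d + 1)) ℝ E}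

lemma lorentz_apply
    (hb : ∀ i j, B (b i) (b j) = if i = j then (if i = 0 then -1 else 1) else 0) (v w : E) :
    B v w = -(b.repr v 0 * b.repr w 0) + ∑ i : Fin d, b.repr v i.succ * b.repr w i.succ := by
  conv_lhs => rw [← b.sum_repr v, ← b.sum_repr w]
  simp only [map_sum, map_smul, sum_apply, smul_apply,
    smul_eq_mul, hb]
  rw [Fin.sum_univ_succ]
  simp [Fin.succ_ne_zero, mul_comm]

lemma lorentz_nondegenerate
    (hb : ∀ i j, B (b i) (b j) = if i = j then (if i = 0 then -1 else 1) else 0) {w : E}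
    (hw : ∀ v, B v w = 0) : w = 0 := by
  refine b.ext_elem fun i => ?_
  have h := hw (b i)
  rw [lorentz_apply hb] at h
  revert h
  refine Fin.cases (fun h => ?_) (fun k h => ?_) i
  · simpa [Finsupp.single_apply] using h
  · simpa [Finsupp.single_apply, Fin.succ_ne_zero] using h

/-- A Lorentzian form is positive definite on the orthogonal complement of a unit time-like
vector, by the Cauchy–Schwarz inequality for the spatial components. -/
lemma lorentz_pos_of_orthogonal
    (hb : ∀ i j, B (b i) (b j) = if i = j then (if i = 0 then -1 else 1) else 0) {x v : E}
    (hx : B x x = -1) (hxv : B x v = 0) (hv : v ≠ 0) : 0 < B v v := by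
  have hcs := Finset.sum_mul_sq_le_sq_mul_sq Finset.univ (fun i : Fin d => b.repr x i.succ)
    (fun i : Fin d => b.repr v i.succ)
  rw [lorentz_apply hb] at hx hxv ⊢
  set x₀ := b.repr x 0
  set v₀ := b.repr v 0
  set p := ∑ i : Fin d, b.repr x i.succ * b.repr v i.succ
  simp only [← pow_two] at hx ⊢
  set X := ∑ i : Fin d, b.repr x i.succ ^ 2
  set S := ∑ i : Fin d, b.repr v i.succ ^ 2 with hS
  have hX0 : 0 ≤ X := Finset.sum_nonneg fun _ _ => sq_nonneg _
  have hS0 : 0 ≤ S := Finset.sum_nonneg fun _ _ => sq_nonneg _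
  have hp : p = x₀ * v₀ := by linarith
  have hx₀ : 0 < x₀ ^ 2 := by linarith
  rcases hS0.eq_or_lt with h | h
  · exfalso
    apply hv
    have hall := (Finset.sum_eq_zero_iff_of_nonneg fun (i : Fin d) _ =>
      sq_nonneg (b.repr v i.succ)).1 (hS.symm.trans h.symm)
    have hv0 : v₀ = 0 := by
      rw [hp, ← h, mul_zero] at hcs
      have h1 : x₀ * v₀ = 0 := by nlinarith [sq_nonneg (x₀ * v₀)]
      rcases mul_eq_zero.1 h1 with h2 | h2
      · rw [h2] at hx₀
        simp at hx₀
      · exact h2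
    refine b.ext_elem fun i => ?_
    refine Fin.cases ?_ (fun k => ?_) i
    · simpa using hv0
    · simpa using hall k (Finset.mem_univ k)
  · rw [hp, mul_pow] at hcs
    have hXe : X = x₀ ^ 2 - 1 := by linarith
    rw [hXe] at hcs
    by_contra hneg
    have h1 : S ≤ v₀ ^ 2 := by linarith
    nlinarith [mul_le_mul_of_nonneg_left h1 hx₀.le]

end Signature

/-! ### The Levi-Civita derivative in a chart -/

section Bilinearity

variable {E : Type*} [NormedAddCommGroup E] [NormedSpace ℝ E]

/-- The covariant differential, as a bilinear form. -/
def covDifferentialForm (G : E → E →L[ℝ] E →L[ℝ] ℝ) (X : E → E) (y : E) :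
    LinearMap.BilinForm ℝ E :=
  LinearMap.mk₂ ℝ (covDifferential G X y)
    (fun a b c => by
      simp only [covDifferential, (fderiv ℝ G y).map_add, (fderiv ℝ X y).map_add,
        ContinuousLinearMap.map_add, add_apply]
      ring)
    (fun a b c => by
      simp only [covDifferential, (fderiv ℝ G y).map_smul, (fderiv ℝ X y).map_smul,
        ContinuousLinearMap.map_smul, smul_apply, smul_eq_mul]
      ring)
    (fun a b c => by
      simp only [covDifferential, (fderiv ℝ G y).map_add, ContinuousLinearMap.map_add, add_apply]
      ring)
    (fun a b c => by
      simp only [covDifferential, (fderiv ℝ G y).map_smul, ContinuousLinearMap.map_smul,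
        smul_apply, smul_eq_mul]
      ring)

lemma trilinear_sum_apply {ι : Type*} [Fintype ι] (T : E →L[ℝ] E →L[ℝ] E →L[ℝ] ℝ) (c : ι → ℝ)
    (a : ι → E) (v w : E) : T (∑ m, c m • a m) v w = ∑ m, c m * T (a m) v w := by
  classical
  induction (Finset.univ : Finset ι) using Finset.induction_on with
  | empty => rw [Finset.sum_empty, Finset.sum_empty, T.map_zero]; rfl
  | insert i s hi ih =>
    rw [Finset.sum_insert hi, Finset.sum_insert hi, T.map_add, T.map_smul, ← ih]
    rfl

end Bilinearity

section ChartCovariantDerivative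

variable {d : ℕ} {M : Type u} [TopologicalSpace M] [ChartedSpace (Model (d + 1)) M]
  {e : OpenPartialHomeomorph M (Model (d + 1))}

lemma mfderiv_symm_bijective (he : e ∈ IsManifold.maximalAtlas 𝓘(ℝ, Model (d + 1)) ∞ M)
    {y : Model (d + 1)} (hy : y ∈ e.target) :
    Function.Bijective (mfderiv 𝓘(ℝ, Model (d + 1)) 𝓘(ℝ, Model (d + 1)) e.symm y) :=
  (mdifferentiable_of_mem_maximalAtlas he).symm.mfderiv_bijective hy

variable [IsManifold 𝓘(ℝ, Model (d + 1)) ∞ M] (g : LorentzMetric d M)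

lemma contDiffOn_chartMetric (he : e ∈ IsManifold.maximalAtlas 𝓘(ℝ, Model (d + 1)) ∞ M) :
    ContDiffOn ℝ ∞ (chartForm g.val e) e.target :=
  contDiffOn_chartForm g.contMDiff he

lemma chartMetric_symm (e : OpenPartialHomeomorph M (Model (d + 1))) (y v w : Model (d + 1)) :
    chartForm g.val e y v w = chartForm g.val e y w v :=
  g.symm _ _ _

lemma metricComp_eq (e : OpenPartialHomeomorph M (Model (d + 1))) (y : Model (d + 1))
    (i j : Fin (d + 1)) :
    metricComp g e y i j =
      chartForm g.val e y (EuclideanSpace.single i 1) (EuclideanSpace.single j 1) := rfl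

lemma lowerComp_eq (he : e ∈ IsManifold.maximalAtlas 𝓘(ℝ, Model (d + 1)) ∞ M)
    (u : (p : M) → TangentSpace 𝓘(ℝ, Model (d + 1)) p) {y : Model (d + 1)} (hy : y ∈ e.target)
    (j : Fin (d + 1)) :
    lowerComp g e u y j = chartForm g.val e y (chartField u e y) (EuclideanSpace.single j 1) := by
  rw [chartForm_apply, mfderiv_symm_chartField he u hy]
  rfl

lemma metric_nondegenerate {p : M} {w : TangentSpace 𝓘(ℝ, Model (d + 1)) p}
    (hw : ∀ v, g.val p v w = 0) : w = 0 := by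
  obtain ⟨b, hb⟩ := g.signature p
  exact lorentz_nondegenerate (E := Model (d + 1)) (B := g.val p) (b := b) hb hw

lemma metric_pos_of_orthogonal {p : M} {x v : TangentSpace 𝓘(ℝ, Model (d + 1)) p}
    (hx : g.val p x x = -1) (hxv : g.val p x v = 0) (hv : v ≠ 0) : 0 < g.val p v v := by
  obtain ⟨b, hb⟩ := g.signature p
  exact lorentz_pos_of_orthogonal (E := Model (d + 1)) (B := g.val p) (b := b) hb hx hxv hv

lemma chartMetric_nondegenerate (he : e ∈ IsManifold.maximalAtlas 𝓘(ℝ, Model (d + 1)) ∞ M)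
    {y : Model (d + 1)} (hy : y ∈ e.target) {w : Model (d + 1)}
    (hw : ∀ v, chartForm g.val e y v w = 0) : w = 0 := by
  obtain ⟨hinj, hsurj⟩ := mfderiv_symm_bijective he hy
  refine hinj (((metric_nondegenerate g) fun v => ?_).trans (map_zero _).symm)
  obtain ⟨v, rfl⟩ := hsurj v
  exact hw v

lemma model_sum_single {n : ℕ} (x : Model n) :
    ∑ i, x i • (EuclideanSpace.single i (1 : ℝ) : Model n) = x := by
  have h := (EuclideanSpace.basisFun (Fin n) ℝ).sum_repr x
  simpa using h

lemma isUnit_det_metricComp (he : e ∈ IsManifold.maximalAtlas 𝓘(ℝ, Model (d + 1)) ∞ M)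
    {y : Model (d + 1)} (hy : y ∈ e.target) : IsUnit (metricComp g e y).det := by
  rw [isUnit_iff_ne_zero]
  intro h0
  obtain ⟨x, hx, hx0⟩ := Matrix.exists_mulVec_eq_zero_iff.2 h0
  apply hx
  have h1 : WithLp.toLp 2 x = (0 : Model (d + 1)) := by
    refine chartMetric_nondegenerate g he hy fun v => ?_
    rw [← model_sum_single v, ← model_sum_single (WithLp.toLp 2 x)]
    simp only [map_sum, map_smul, sum_apply, smul_apply, smul_eq_mul]
    simp only [Finset.mul_sum]
    rw [Finset.sum_comm]
    refine Finset.sum_eq_zero fun i _ => ?_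
    have h2 := congrFun hx0 i
    simp only [Matrix.mulVec, dotProduct, metricComp_eq, Pi.zero_apply] at h2
    rw [← mul_zero (v i), ← h2, Finset.mul_sum]
    exact Finset.sum_congr rfl fun j _ => by ring
  funext i
  exact congrArg (fun z : Model (d + 1) => z i) h1

lemma partialDeriv_metricComp (he : e ∈ IsManifold.maximalAtlas 𝓘(ℝ, Model (d + 1)) ∞ M)
    {y : Model (d + 1)} (hy : y ∈ e.target) (i j k : Fin (d + 1)) :
    partialDeriv i (fun z => metricComp g e z j k) y =
      fderiv ℝ (chartForm g.val e) y (EuclideanSpace.single i 1) (EuclideanSpace.single j 1)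
        (EuclideanSpace.single k 1) := by
  have hG : DifferentiableAt ℝ (chartForm g.val e) y :=
    ((contDiffOn_chartMetric g he).contDiffAt (e.open_target.mem_nhds hy)).differentiableAt
      (by simp)
  simp only [partialDeriv, metricComp_eq]
  rw [((hG.hasFDerivAt.clm_apply (hasFDerivAt_const _ y)).clm_apply (hasFDerivAt_const _ y)).fderiv]
  simp

/-- The covariant derivative, defined through the Christoffel symbols, is the covariant
differential of the chart expressions. -/
theorem covDeriv_eq_covDifferential
    (he : e ∈ IsManifold.maximalAtlas 𝓘(ℝ, Model (d + 1)) ∞ M)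
    (u : (p : M) → TangentSpace 𝓘(ℝ, Model (d + 1)) p) {y : Model (d + 1)} (hy : y ∈ e.target)
    (hX : DifferentiableAt ℝ (chartField u e) y) (i j : Fin (d + 1)) :
    covDeriv g e u y i j = covDifferential (chartForm g.val e) (chartField u e) y
      (EuclideanSpace.single i 1) (EuclideanSpace.single j 1) := by
  set G := chartForm g.val e with hGdef
  set X := chartField u e with hXdef
  have hG : DifferentiableAt ℝ G y :=
    ((contDiffOn_chartMetric g he).contDiffAt (e.open_target.mem_nhds hy)).differentiableAt
      (by simp)
  have h1 : partialDeriv i (fun z => lowerComp g e u z j) y =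
      fderiv ℝ G y (EuclideanSpace.single i 1) (X y) (EuclideanSpace.single j 1)
        + G y (fderiv ℝ X y (EuclideanSpace.single i 1)) (EuclideanSpace.single j 1) := by
    have h2 : (fun z => lowerComp g e u z j) =ᶠ[nhds y]
        fun z => G z (X z) (EuclideanSpace.single j 1) := by
      filter_upwards [e.open_target.mem_nhds hy] with z hz using lowerComp_eq g he u hz j
    rw [partialDeriv, h2.fderiv_eq]
    rw [((hG.hasFDerivAt.clm_apply hX.hasFDerivAt).clm_apply (hasFDerivAt_const _ y)).fderiv]
    simp [add_comm]
  -- contracting with `u` removes the inverse metric from the Christoffel symbols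
  have h3 : ∀ S : Fin (d + 1) → ℝ,
      ∑ k, ((1 / 2) * ∑ m, (metricComp g e y)⁻¹ k m * S m) * lowerComp g e u y k =
        (1 / 2) * ∑ m, X y m * S m := by
    intro S
    have h4 : (fun k => lowerComp g e u y k) = Matrix.vecMul (X y) (metricComp g e y) := by
      funext k
      rw [lowerComp_eq g he u hy, ← hGdef, ← hXdef]
      conv_lhs => rw [← model_sum_single (X y)]
      simp only [map_sum, map_smul, sum_apply, smul_apply, smul_eq_mul, Matrix.vecMul, dotProduct,
        metricComp_eq]
      rfl
    have h5 : ∑ k, ((1 / 2) * ∑ m, (metricComp g e y)⁻¹ k m * S m) * lowerComp g e u y k =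
        (1 / 2) * dotProduct (fun k => lowerComp g e u y k)
          (Matrix.mulVec (metricComp g e y)⁻¹ S) := by
      simp only [dotProduct, Matrix.mulVec, Finset.mul_sum, Finset.sum_mul]
      refine Finset.sum_congr rfl fun k _ => Finset.sum_congr rfl fun m _ => by ring
    rw [h5, h4, Matrix.dotProduct_mulVec, Matrix.vecMul_vecMul,
      Matrix.mul_nonsing_inv _ (isUnit_det_metricComp g he hy), Matrix.vecMul_one]
    rfl
  have hs := fderiv_symm_of_eventually hG
    (Filter.Eventually.of_forall fun z v w => chartMetric_symm g e z v w)
  have h6 : ∑ m, X y m * (partialDeriv i (fun z => metricComp g e z j m) y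
      + partialDeriv j (fun z => metricComp g e z i m) y
      - partialDeriv m (fun z => metricComp g e z i j) y) =
      fderiv ℝ G y (EuclideanSpace.single i 1) (EuclideanSpace.single j 1) (X y)
      + fderiv ℝ G y (EuclideanSpace.single j 1) (EuclideanSpace.single i 1) (X y)
      - fderiv ℝ G y (X y) (EuclideanSpace.single i 1) (EuclideanSpace.single j 1) := by
    have h7 : ∀ (L : Model (d + 1) →L[ℝ] ℝ), L (X y) =
        ∑ m, X y m * L (EuclideanSpace.single m 1) := fun L => by
      conv_lhs => rw [← model_sum_single (X y)]
      simp only [map_sum, map_smul, smul_eq_mul]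
    have h8 : fderiv ℝ G y (X y) (EuclideanSpace.single i 1) (EuclideanSpace.single j 1) =
        ∑ m, X y m * fderiv ℝ G y (EuclideanSpace.single m 1) (EuclideanSpace.single i 1)
          (EuclideanSpace.single j 1) := by
      conv_lhs => rw [← model_sum_single (X y)]
      exact trilinear_sum_apply _ _ _ _ _
    rw [h7, h7, h8, ← Finset.sum_add_distrib, ← Finset.sum_sub_distrib]
    refine Finset.sum_congr rfl fun m _ => ?_
    rw [partialDeriv_metricComp g he hy, partialDeriv_metricComp g he hy,
      partialDeriv_metricComp g he hy, ← hGdef]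
    ring
  simp only [covDeriv, christoffel]
  rw [h3, h6, h1, covDifferential, hs (EuclideanSpace.single i 1) (X y) (EuclideanSpace.single j 1),
    hs (EuclideanSpace.single j 1) (X y) (EuclideanSpace.single i 1)]
  ring

/-- A torse-forming time-like unit vector field is torse-forming in each chart, as an identity of
bilinear forms rather than of components. -/
theorem IsTorseFormingUnitTimelikeOn.exists_local {g : LorentzMetric d M}
    {u : (p : M) → TangentSpace 𝓘(ℝ, Model (d + 1)) p} {U : Set M} (hU : IsOpen U)
    (hu : IsTorseFormingUnitTimelikeOn g u U)
    (he : e ∈ IsManifold.maximalAtlas 𝓘(ℝ, Model (d + 1)) ∞ M) :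
    ∃ φ, IsLocalTorseForming (e.target ∩ e.symm ⁻¹' U) (chartForm g.val e) (chartField u e) φ := by
  obtain ⟨husmooth, hunit, φ, -, htorse⟩ := hu
  have hopen : IsOpen (e.target ∩ e.symm ⁻¹' U) := e.isOpen_inter_preimage_symm hU
  have hXs := contDiffOn_chartField he husmooth
  refine ⟨φ ∘ e.symm, hopen, (contDiffOn_chartMetric g he).mono inter_subset_left, hXs,
    fun y _ => chartMetric_symm g e y, ?_, ?_, ?_⟩
  · intro y hy
    rw [chartForm_apply, mfderiv_symm_chartField he u hy.1]
    exact hunit _ hy.2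
  · intro y hy v hv hv0
    rw [chartForm_apply, mfderiv_symm_chartField he u hy.1] at hv
    refine metric_pos_of_orthogonal g (hunit _ hy.2) hv fun h0 => hv0 ?_
    exact (mfderiv_symm_bijective he hy.1).1 (h0.trans (map_zero _).symm)
  · intro y hy
    have hX : DifferentiableAt ℝ (chartField u e) y :=
      (hXs.contDiffAt (hopen.mem_nhds hy)).differentiableAt (by simp)
    set G := chartForm g.val e with hGdef
    set X := chartField u e with hXdef
    -- both sides are bilinear, so it is enough to compare them on the coordinate vectors
    let B₂ : LinearMap.BilinForm ℝ (Model (d + 1)) :=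
      LinearMap.mk₂ ℝ (fun v w => φ (e.symm y) * (G y (X y) v * G y (X y) w + G y v w))
        (fun a b c => by simp only [map_add, add_apply]; ring)
        (fun a b c => by simp only [map_smul, smul_apply, smul_eq_mul]; ring)
        (fun a b c => by simp only [map_add]; ring)
        (fun a b c => by simp only [map_smul, smul_eq_mul]; ring)
    have hB : covDifferentialForm G X y = B₂ := by
      refine LinearMap.BilinForm.ext_basis (EuclideanSpace.basisFun (Fin (d + 1)) ℝ).toBasis
        fun i j => ?_
      have h := htorse e he (e.symm y) ⟨hy.2, e.map_target hy.1⟩ i j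
      rw [e.right_inv hy.1, covDeriv_eq_covDifferential g he u hy.1 hX, lowerComp_eq g he u hy.1,
        lowerComp_eq g he u hy.1, metricComp_eq] at h
      simpa [covDifferentialForm, B₂] using h
    intro v w
    exact congrArg (fun B : LinearMap.BilinForm ℝ (Model (d + 1)) => B v w) hB

end ChartCovariantDerivative

/-! ### Riemannian metrics on a vector space -/

section RiemannianMetric

/-- A positive definite bilinear form on a finite-dimensional space has a bounded unit ball. -/
lemma isVonNBounded_of_posDef {F : Type*} [NormedAddCommGroup F] [NormedSpace ℝ F]
    [FiniteDimensional ℝ F] (B : F →L[ℝ] F →L[ℝ] ℝ) (hB : ∀ v, v ≠ 0 → 0 < B v v) :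
    Bornology.IsVonNBounded ℝ {v : F | B v v < 1} := by
  have : ProperSpace F := FiniteDimensional.proper ℝ F
  rcases subsingleton_or_nontrivial F with hF | hF
  · exact (Set.subsingleton_of_subsingleton.finite).isVonNBounded
  -- the minimum of the form on the unit sphere
  obtain ⟨x, hx, hmin⟩ := (isCompact_sphere (0 : F) 1).exists_isMinOn
    (NormedSpace.sphere_nonempty.2 zero_le_one)
    (f := fun v => B v v) (B.continuous.clm_apply continuous_id).continuousOn
  have hx1 : ‖x‖ = 1 := by simpa using hx
  have hc : 0 < B x x := hB x (norm_ne_zero_iff.1 (by rw [hx1]; exact one_ne_zero))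
  refine (NormedSpace.isVonNBounded_ball ℝ F (1 / B x x + 1)).subset fun v hv => ?_
  rw [mem_ball_zero_iff]
  rw [mem_ofPred_eq] at hv
  rcases eq_or_ne v 0 with rfl | hv0
  · rw [norm_zero]; positivity
  have hn : 0 < ‖v‖ := norm_pos_iff.2 hv0
  have h1 : B x x ≤ B (‖v‖⁻¹ • v) (‖v‖⁻¹ • v) :=
    hmin (by simp [norm_smul, inv_mul_cancel₀ hn.ne'])
  have h2 : B x x * ‖v‖ ^ 2 ≤ B v v := by
    simp only [map_smul, smul_apply, smul_eq_mul] at h1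
    calc B x x * ‖v‖ ^ 2 ≤ (‖v‖⁻¹ * (‖v‖⁻¹ * B v v)) * ‖v‖ ^ 2 := by gcongr
      _ = B v v := by field_simp
  by_contra! hle
  have h3 : B x x * (1 / B x x + 1) ≤ B x x * ‖v‖ := by gcongr
  have h4 : B x x * (1 / B x x + 1) = 1 + B x x := by field_simp
  have h6 : 0 < 1 / B x x := by positivity
  have h5 : 1 ≤ ‖v‖ := by linarith
  nlinarith

/-- A field of bilinear forms on a vector space, as forms on its tangent spaces. -/
def tangentForm {F : Type} [NormedAddCommGroup F] [NormedSpace ℝ F]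
    (H : F → F →L[ℝ] F →L[ℝ] ℝ) (x : F) :
    TangentSpace 𝓘(ℝ, F) x →L[ℝ] TangentSpace 𝓘(ℝ, F) x →L[ℝ] ℝ := H x

lemma contMDiff_tangentForm {F : Type} [NormedAddCommGroup F] [NormedSpace ℝ F]
    {H : F → F →L[ℝ] F →L[ℝ] ℝ} (hH : ContDiff ℝ ∞ H) :
    ContMDiff 𝓘(ℝ, F) (𝓘(ℝ, F).prod 𝓘(ℝ, F →L[ℝ] F →L[ℝ] ℝ)) ∞
      (fun x => Bundle.TotalSpace.mk' (F →L[ℝ] F →L[ℝ] ℝ)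
        (E := fun x : F => TangentSpace 𝓘(ℝ, F) x →L[ℝ] TangentSpace 𝓘(ℝ, F) x →L[ℝ] ℝ) x
          (tangentForm H x)) := by
  intro x
  rw [Bundle.contMDiffAt_section]
  refine (hH.contMDiff x).congr_of_eventuallyEq (Filter.Eventually.of_forall fun y => ?_)
  ext v w
  have hy : y ∈ (trivializationAt F (TangentSpace 𝓘(ℝ, F)) x).baseSet := mem_univ y
  have hsym : ∀ a : F, (trivializationAt F (TangentSpace 𝓘(ℝ, F)) x).symm y a = a := fun a => by
    rw [← Bundle.Trivialization.symmL_apply (R := ℝ) _ hy, TangentBundle.symmL_model_space]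
    rfl
  have h := inCoordinates_apply_eq₂ (F₁ := F) (F₂ := F) (F₃ := ℝ)
    (E₁ := fun x : F => TangentSpace 𝓘(ℝ, F) x) (E₂ := fun x : F => TangentSpace 𝓘(ℝ, F) x)
    (E₃ := Bundle.Trivial F ℝ) (x₀ := x) (x := y)
    (ϕ := tangentForm H y) (v := v) (w := w) hy hy (mem_univ y)
  refine Eq.trans h ?_
  rw [hsym, hsym]
  exact congrArg (fun L : ℝ →ₗ[ℝ] ℝ => L (H y v w))
    (Bundle.Trivial.linearMapAt_trivialization (𝕜 := ℝ) (B := F) (F := ℝ) y)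

/-- A smooth field of inner products on a vector space, as a Riemannian metric. -/
def riemannianMetricOfForm {F : Type} [NormedAddCommGroup F] [NormedSpace ℝ F]
    [FiniteDimensional ℝ F] (H : F → F →L[ℝ] F →L[ℝ] ℝ) (hH : ContDiff ℝ ∞ H)
    (hsymm : ∀ z v w, H z v w = H z w v) (hpos : ∀ z v, v ≠ 0 → 0 < H z v v) :
    Bundle.ContMDiffRiemannianMetric 𝓘(ℝ, F) ∞ F (fun x : F => TangentSpace 𝓘(ℝ, F) x) where
  inner := tangentForm H
  symm x v w := hsymm x v w
  pos x v hv := hpos x v hv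
  isVonNBounded x := isVonNBounded_of_posDef (H x) (hpos x)
  contMDiff := contMDiff_tangentForm hH

end RiemannianMetric

/-! ### A torse-forming field gives a local twisted product -/

section ToTwisted

variable {d : ℕ} {M : Type u} [TopologicalSpace M] [ChartedSpace (Model (d + 1)) M]
  [IsManifold 𝓘(ℝ, Model (d + 1)) ∞ M]

/-- A torse-forming time-like unit vector field gives a twisted product near each point, with fibre
the coordinate space. -/
theorem IsTorseFormingUnitTimelikeOn.exists_isTwistedProductOn {g : LorentzMetric d M}
    {u : (p : M) → TangentSpace 𝓘(ℝ, Model (d + 1)) p} {U : Set M} (hU : IsOpen U)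
    (hu : IsTorseFormingUnitTimelikeOn g u U) {p : M} (hp : p ∈ U) :
    ∃ W : Set M, IsOpen W ∧ p ∈ W ∧ IsTwistedProductOn.{0, u} g W := by
  set e₀ : OpenPartialHomeomorph M (Model (d + 1)) := chartAt (Model (d + 1)) p with he₀
  have he : e₀ ∈ IsManifold.maximalAtlas 𝓘(ℝ, Model (d + 1)) ∞ M :=
    IsManifold.chart_mem_maximalAtlas p
  have hmd := mdifferentiable_of_mem_maximalAtlas he
  have hpe : p ∈ e₀.source := mem_chart_source _ p
  obtain ⟨φ, hφ⟩ := hu.exists_local hU he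
  obtain ⟨ψ, ε, H, f, hε, hψp, hψV, hψt, hψs, hψsymm, hH, hHs, hHp, hf, hf0, hG⟩ :=
    hφ.exists_twisted_coordinates (F := Model d) (y₀ := e₀ p) (by simp)
      ⟨e₀.map_source hpe, by simpa [e₀.left_inv hpe] using hp⟩
  have hψe : ψ.source ⊆ e₀.target := fun y hy => (hψV hy).1
  let e : OpenPartialHomeomorph M (ℝ × Model d) := e₀.trans ψ
  have hes : e.source = e₀.source ∩ e₀ ⁻¹' ψ.source := e₀.trans_source ψ
  have het : e.target = ψ.target := by
    refine (e₀.trans_target ψ).trans (inter_eq_left.2 fun z hz => hψe (ψ.map_target hz))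
  refine ⟨e.source, e.open_source, ?_, Ioo (-ε) ε, Model d, inferInstance, inferInstance,
    inferInstance, riemannianMetricOfForm H hH hHs hHp, f, e,
    ⟨isOpen_Ioo, ordConnected_Ioo, 0, by simpa using hε⟩, ?_, ?_, rfl, ?_, ?_, ?_, ?_⟩
  · rw [hes]
    exact ⟨hpe, hψp⟩
  · rw [← modelWithCornersSelf_prod, chartedSpaceSelf_prod, ← hψt]
    exact hf.contMDiffOn
  · rw [← hψt]
    exact hf0
  · rw [het, hψt]
  · rw [hes, ← modelWithCornersSelf_prod, chartedSpaceSelf_prod]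
    exact hψs.contMDiffOn.comp ((contMDiffOn_of_mem_maximalAtlas he).mono inter_subset_left)
      inter_subset_right
  · have h := (contMDiffOn_symm_of_mem_maximalAtlas he).comp hψsymm.contMDiffOn
      fun z hz => hψe (ψ.map_target hz)
    rw [modelWithCornersSelf_prod, ← chartedSpaceSelf_prod] at h
    rw [het]
    exact h
  · intro q hq v w
    rw [hes] at hq
    have hψd : DifferentiableAt ℝ ψ (e₀ q) :=
      (hψs.contDiffAt (ψ.open_source.mem_nhds hq.2)).differentiableAt (by simp)
    have hed : MDifferentiableAt 𝓘(ℝ, Model (d + 1)) 𝓘(ℝ, Model (d + 1)) e₀ q :=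
      hmd.mdifferentiableAt hq.1
    have h1 : ∀ a : TangentSpace 𝓘(ℝ, Model (d + 1)) q,
        mfderiv 𝓘(ℝ, Model (d + 1)) 𝓘(ℝ, ℝ) (fun x => (e x).1) q a =
          (fderiv ℝ ψ (e₀ q) (mfderiv 𝓘(ℝ, Model (d + 1)) 𝓘(ℝ, Model (d + 1)) e₀ q a)).1 := by
      intro a
      have := mfderiv_comp q (g := fun y => (ψ y).1) (I' := 𝓘(ℝ, Model (d + 1))) (I'' := 𝓘(ℝ, ℝ))
        hψd.fst.mdifferentiableAt hed
      rw [mfderiv_eq_fderiv, fderiv.fst hψd] at this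
      exact congrArg (fun L => L a) this
    have h2 : ∀ a : TangentSpace 𝓘(ℝ, Model (d + 1)) q,
        mfderiv 𝓘(ℝ, Model (d + 1)) 𝓘(ℝ, Model d) (fun x => (e x).2) q a =
          (fderiv ℝ ψ (e₀ q) (mfderiv 𝓘(ℝ, Model (d + 1)) 𝓘(ℝ, Model (d + 1)) e₀ q a)).2 := by
      intro a
      have := mfderiv_comp q (g := fun y => (ψ y).2) (I' := 𝓘(ℝ, Model (d + 1)))
        (I'' := 𝓘(ℝ, Model d)) hψd.snd.mdifferentiableAt hed
      rw [mfderiv_eq_fderiv, fderiv.snd hψd] at this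
      exact congrArg (fun L => L a) this
    have key : ∀ (c a a' b b' : ℝ) (z x x' y y' : Model d), a = a' → b = b' → x = x' → y = y' →
        -(a * b) + c ^ 2 * H z x y = -(a' * b') + c ^ 2 * H z x' y' := by
      rintro c a _ b _ z x _ y _ rfl rfl rfl rfl
      rfl
    refine Eq.trans ?_ (key _ _ _ _ _ _ _ _ _ _ (h1 v) (h1 w) (h2 v) (h2 w)).symm
    have h3 := hG (e₀ q) hq.2 (mfderiv 𝓘(ℝ, Model (d + 1)) 𝓘(ℝ, Model (d + 1)) e₀ q v)
      (mfderiv 𝓘(ℝ, Model (d + 1)) 𝓘(ℝ, Model (d + 1)) e₀ q w)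
    exact (chartForm_mfderiv g.val he hq.1 v w).symm.trans h3

end ToTwisted

/-! ### The time direction of a twisted product is torse-forming -/

section TimeField

variable {E F : Type*} [NormedAddCommGroup E] [NormedSpace ℝ E]
  [NormedAddCommGroup F] [NormedSpace ℝ F]
  {M N : Type*} [TopologicalSpace M] [ChartedSpace E M] [TopologicalSpace N] [ChartedSpace F N]

/-- The field `∂/∂t` of a product parametrization `e` by `ℝ × N`. -/
def timeField (e : OpenPartialHomeomorph M (ℝ × N)) (p : M) : TangentSpace 𝓘(ℝ, E) p :=
  let D : ℝ × F →L[ℝ] E := mfderiv (𝓘(ℝ, ℝ).prod 𝓘(ℝ, F)) 𝓘(ℝ, E) e.symm (e p)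
  D (1, 0)

variable {e : OpenPartialHomeomorph M (ℝ × N)}

lemma contMDiffOn_timeField [IsManifold 𝓘(ℝ, E) ∞ M] [IsManifold 𝓘(ℝ, F) ∞ N]
    (he : ContMDiffOn 𝓘(ℝ, E) (𝓘(ℝ, ℝ).prod 𝓘(ℝ, F)) ∞ e e.source)
    (he' : ContMDiffOn (𝓘(ℝ, ℝ).prod 𝓘(ℝ, F)) 𝓘(ℝ, E) ∞ e.symm e.target) :
    ContMDiffOn 𝓘(ℝ, E) 𝓘(ℝ, E).tangent ∞
      (fun p => (⟨p, timeField (E := E) (F := F) e p⟩ : TangentBundle 𝓘(ℝ, E) M)) e.source := by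
  have : IsManifold 𝓘(ℝ, F) 1 N := IsManifold.of_le (n := ∞) (by simp)
  have h1 := he'.contMDiffOn_tangentMapWithin (m := ∞) (by simp) e.open_target.uniqueMDiffOn
  have h2 : ContMDiff 𝓘(ℝ, ℝ) 𝓘(ℝ, ℝ).tangent ∞
      (fun t => (⟨t, (1 : ℝ)⟩ : TangentBundle 𝓘(ℝ, ℝ) ℝ)) :=
    contMDiff_vectorSpace_iff_contDiff.2 contDiff_const
  have h3 : ContMDiff 𝓘(ℝ, F) 𝓘(ℝ, F).tangent ∞
      (Bundle.zeroSection F (TangentSpace 𝓘(ℝ, F) : N → Type _)) :=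
    Bundle.contMDiff_zeroSection ℝ _
  have h4 : ContMDiff (𝓘(ℝ, ℝ).prod 𝓘(ℝ, F)) (𝓘(ℝ, ℝ).prod 𝓘(ℝ, F)).tangent ∞
      (fun z : ℝ × N => (equivTangentBundleProd 𝓘(ℝ, ℝ) ℝ 𝓘(ℝ, F) N).symm
        (⟨z.1, (1 : ℝ)⟩, Bundle.zeroSection F (TangentSpace 𝓘(ℝ, F) : N → Type _) z.2)) :=
    contMDiff_equivTangentBundleProd_symm.comp
      ((h2.comp contMDiff_fst).prodMk (h3.comp contMDiff_snd))
  refine (h1.comp (h4.comp_contMDiffOn he) fun p hp => e.map_source hp).congr fun p hp => ?_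
  have h5 : ∀ (q : M) (_ : q = p) (a : E),
      (⟨p, a⟩ : TangentBundle 𝓘(ℝ, E) M) = ⟨q, a⟩ := by
    rintro q rfl a
    rfl
  refine (h5 _ (e.left_inv hp) _).trans ?_
  simp only [Function.comp, tangentMapWithin]
  refine Bundle.TotalSpace.ext rfl (heq_of_eq ?_)
  dsimp only
  change _ = mfderivWithin (𝓘(ℝ, ℝ).prod 𝓘(ℝ, F)) 𝓘(ℝ, E) e.symm e.target (e p) _
  rw [mfderivWithin_of_isOpen e.open_target (e.map_source hp)]
  rfl

/-- The chain rule for `G ∘ e⁻¹` at `e p`, in the direction of time. -/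
lemma mfderiv_timeField {E' : Type*} [NormedAddCommGroup E'] [NormedSpace ℝ E']
    {M' : Type*} [TopologicalSpace M'] [ChartedSpace E' M']
    (he' : ContMDiffOn (𝓘(ℝ, ℝ).prod 𝓘(ℝ, F)) 𝓘(ℝ, E) ∞ e.symm e.target)
    {k : M → M'} {p : M} (hp : p ∈ e.source) (hk : MDifferentiableAt 𝓘(ℝ, E) 𝓘(ℝ, E') k p) :
    (mfderiv 𝓘(ℝ, E) 𝓘(ℝ, E') k p (timeField (F := F) e p) : E') =
      mfderiv (𝓘(ℝ, ℝ).prod 𝓘(ℝ, F)) 𝓘(ℝ, E') (k ∘ e.symm) (e p) ((1 : ℝ), (0 : F)) := by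
  have hd : MDifferentiableAt (𝓘(ℝ, ℝ).prod 𝓘(ℝ, F)) 𝓘(ℝ, E) e.symm (e p) :=
    (he'.contMDiffAt (e.open_target.mem_nhds (e.map_source hp))).mdifferentiableAt (by simp)
  have h := mfderiv_comp_of_eq hk hd (e.left_inv hp)
  have h1 : ∀ (q : M) (_ : q = p) (a : E), (mfderiv 𝓘(ℝ, E) 𝓘(ℝ, E') k q a : E') =
      (mfderiv 𝓘(ℝ, E) 𝓘(ℝ, E') k p a : E') := by
    rintro q rfl a
    rfl
  refine Eq.trans ?_ (congrArg (fun L : ℝ × F →L[ℝ] E' => L (1, 0)) h).symm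
  exact (h1 _ (e.left_inv hp) _).symm

lemma mfderiv_fst_timeField
    (he : ContMDiffOn 𝓘(ℝ, E) (𝓘(ℝ, ℝ).prod 𝓘(ℝ, F)) ∞ e e.source)
    (he' : ContMDiffOn (𝓘(ℝ, ℝ).prod 𝓘(ℝ, F)) 𝓘(ℝ, E) ∞ e.symm e.target)
    {p : M} (hp : p ∈ e.source) :
    (mfderiv 𝓘(ℝ, E) 𝓘(ℝ, ℝ) (fun q => (e q).1) p (timeField (F := F) e p) : ℝ) = 1 := by
  have hd := (he.contMDiffAt (e.open_source.mem_nhds hp)).mdifferentiableAt (by simp)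
  rw [mfderiv_timeField he' hp hd.fst]
  have h : ((fun q => (e q).1) ∘ e.symm) =ᶠ[nhds (e p)] Prod.fst := by
    filter_upwards [e.open_target.mem_nhds (e.map_source hp)] with z hz
    simp [e.right_inv hz]
  rw [h.mfderiv_eq, mfderiv_fst]
  rfl

lemma mfderiv_snd_timeField
    (he : ContMDiffOn 𝓘(ℝ, E) (𝓘(ℝ, ℝ).prod 𝓘(ℝ, F)) ∞ e e.source)
    (he' : ContMDiffOn (𝓘(ℝ, ℝ).prod 𝓘(ℝ, F)) 𝓘(ℝ, E) ∞ e.symm e.target)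
    {p : M} (hp : p ∈ e.source) :
    (mfderiv 𝓘(ℝ, E) 𝓘(ℝ, F) (fun q => (e q).2) p (timeField (F := F) e p) : F) = 0 := by
  have hd := (he.contMDiffAt (e.open_source.mem_nhds hp)).mdifferentiableAt (by simp)
  rw [mfderiv_timeField he' hp hd.snd]
  have h : ((fun q => (e q).2) ∘ e.symm) =ᶠ[nhds (e p)] Prod.snd := by
    filter_upwards [e.open_target.mem_nhds (e.map_source hp)] with z hz
    simp [e.right_inv hz]
  rw [h.mfderiv_eq, mfderiv_snd]
  rfl

end TimeField

section FromTwisted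

universe v v'

variable {d : ℕ} {M : Type v'} [TopologicalSpace M] [ChartedSpace (Model (d + 1)) M]
  [IsManifold 𝓘(ℝ, Model (d + 1)) ∞ M]

/-- The time direction of a twisted product is a torse-forming time-like unit vector field, with
scalar `∂ₜf / f`. -/
theorem IsTwistedProductOn.exists_isTorseFormingUnitTimelikeOn {g : LorentzMetric d M} {U : Set M}
    (h : IsTwistedProductOn.{v, v'} g U) : ∃ u, IsTorseFormingUnitTimelikeOn g u U := by
  obtain ⟨J, N, _, _, _, gN, f, e, -, hf, hf0, rfl, het, hes, hesymm, hg⟩ := h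
  rw [← het] at hf hf0
  set u : (p : M) → TangentSpace 𝓘(ℝ, Model (d + 1)) p := timeField (F := Model d) e with hu
  have husmooth := contMDiffOn_timeField hes hesymm
  rw [← hu] at husmooth
  have hfe : ContMDiffOn 𝓘(ℝ, Model (d + 1)) 𝓘(ℝ, ℝ) ∞ (f ∘ e) e.source :=
    hf.comp hes fun p hp => e.map_source hp
  refine ⟨u, husmooth, fun p hp => ?_,
    fun p =>
      let D : Model (d + 1) →L[ℝ] ℝ := mfderiv 𝓘(ℝ, Model (d + 1)) 𝓘(ℝ, ℝ) (f ∘ e) p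
      D (u p) / f (e p), ?_, ?_⟩
  · have key : ∀ (c a : ℝ) (n : N) (x : TangentSpace 𝓘(ℝ, Model d) n), a = 1 → x = 0 →
        -(a * a) + c ^ 2 * gN.inner n x x = -1 := by
      rintro c a n x rfl rfl
      simp
    exact (hg p hp (u p) (u p)).trans
      (key _ _ _ _ (mfderiv_fst_timeField hes hesymm hp) (mfderiv_snd_timeField hes hesymm hp))
  · have h1 := (contMDiff_snd_tangentBundle_modelSpace ℝ 𝓘(ℝ, ℝ) (n := ∞)).comp_contMDiffOn
      ((hfe.contMDiffOn_tangentMapWithin (m := ∞) (by simp) e.open_source.uniqueMDiffOn).comp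
        husmooth fun p hp => hp)
    refine ContMDiffOn.div₀ (h1.congr fun p hp => ?_) hfe fun p hp => (hf0 _ (e.map_source hp)).ne'
    simp only [Function.comp, tangentMapWithin]
    rw [mfderivWithin_of_isOpen e.open_source hp]
    rfl
  · rintro c hc p ⟨hp, hpc⟩ i j
    set b : OpenPartialHomeomorph N (Model d) := chartAt (Model d) (e p).2 with hb
    have hbm : b ∈ IsManifold.maximalAtlas 𝓘(ℝ, Model d) ∞ N :=
      IsManifold.chart_mem_maximalAtlas _
    have hbd := mdifferentiable_of_mem_maximalAtlas hbm
    have hcd := mdifferentiable_of_mem_maximalAtlas hc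
    -- the part of the chart domain on which the twisted coordinates are defined
    set W : Set M := e.source ∩ e ⁻¹' (univ ×ˢ b.source) with hW
    have hWo : IsOpen W := e.isOpen_inter_preimage (isOpen_univ.prod b.open_source)
    set Ω : Set (Model (d + 1)) := c.target ∩ c.symm ⁻¹' W with hΩ
    have hΩo : IsOpen Ω := c.isOpen_inter_preimage_symm hWo
    have hpΩ : c p ∈ Ω := by
      refine ⟨c.map_source hpc, ?_⟩
      rw [mem_preimage, c.left_inv hpc]
      exact ⟨hp, mem_univ _, mem_chart_source _ _⟩
    have hnhds : Ω ∈ nhds (c p) := hΩo.mem_nhds hpΩ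
    have hcs : ContMDiffOn 𝓘(ℝ, Model (d + 1)) 𝓘(ℝ, Model (d + 1)) ∞ c.symm Ω :=
      (contMDiffOn_symm_of_mem_maximalAtlas hc).mono inter_subset_left
    have hec : ContMDiffOn 𝓘(ℝ, Model (d + 1)) (𝓘(ℝ, ℝ).prod 𝓘(ℝ, Model d)) ∞
        (fun z => e (c.symm z)) Ω := hes.comp hcs fun z hz => hz.2.1
    have hτ : ContDiffOn ℝ ∞ (fun z => (e (c.symm z)).1) Ω :=
      contMDiffOn_iff_contDiffOn.1 (contMDiff_fst.comp_contMDiffOn hec)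
    have hx : ContDiffOn ℝ ∞ (fun z => b (e (c.symm z)).2) Ω :=
      contMDiffOn_iff_contDiffOn.1 ((contMDiffOn_of_mem_maximalAtlas hbm).comp
        (contMDiff_snd.comp_contMDiffOn hec) fun z hz => hz.2.2.2)
    have hfc : ContDiffOn ℝ ∞ (fun z => f (e (c.symm z))) Ω :=
      contMDiffOn_iff_contDiffOn.1 (hfe.comp hcs fun z hz => hz.2.1)
    have hX : ContDiffOn ℝ ∞ (chartField u c) Ω :=
      (contDiffOn_chartField hc husmooth).mono fun z hz => ⟨hz.1, hz.2.1⟩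
    have hmc : ∀ z ∈ Ω, MDifferentiableAt 𝓘(ℝ, Model (d + 1)) 𝓘(ℝ, Model (d + 1)) c.symm z :=
      fun z hz => hcd.mdifferentiableAt_symm hz.1
    have hme : ∀ z ∈ Ω, MDifferentiableAt 𝓘(ℝ, Model (d + 1)) (𝓘(ℝ, ℝ).prod 𝓘(ℝ, Model d)) e
        (c.symm z) := fun z hz =>
      (hes.contMDiffAt (e.open_source.mem_nhds hz.2.1)).mdifferentiableAt (by simp)
    have hdτ : ∀ z ∈ Ω, ∀ v : Model (d + 1), fderiv ℝ (fun z => (e (c.symm z)).1) z v =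
        (mfderiv 𝓘(ℝ, Model (d + 1)) 𝓘(ℝ, ℝ) (fun q => (e q).1) (c.symm z)
          (mfderiv 𝓘(ℝ, Model (d + 1)) 𝓘(ℝ, Model (d + 1)) c.symm z v) : ℝ) := fun z hz v => by
      rw [← mfderiv_eq_fderiv]
      exact mfderiv_comp_apply z (hme z hz).fst (hmc z hz) v
    have hdx : ∀ z ∈ Ω, ∀ v : Model (d + 1), fderiv ℝ (fun z => b (e (c.symm z)).2) z v =
        (mfderiv 𝓘(ℝ, Model d) 𝓘(ℝ, Model d) b (e (c.symm z)).2
          (mfderiv 𝓘(ℝ, Model (d + 1)) 𝓘(ℝ, Model d) (fun q => (e q).2) (c.symm z)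
            (mfderiv 𝓘(ℝ, Model (d + 1)) 𝓘(ℝ, Model (d + 1)) c.symm z v)) : Model d) :=
        fun z hz v => by
      rw [← mfderiv_eq_fderiv]
      have hb1 := hbd.mdifferentiableAt hz.2.2.2
      refine (mfderiv_comp_apply z (g := fun q => b (e q).2)
        (hb1.comp (c.symm z) (hme z hz).snd) (hmc z hz) v).trans ?_
      exact mfderiv_comp_apply (c.symm z) (g := b) (f := fun q => (e q).2)
        hb1 (hme z hz).snd _
    have hdf : ∀ z ∈ Ω, ∀ v : Model (d + 1), fderiv ℝ (fun z => f (e (c.symm z))) z v =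
        (mfderiv 𝓘(ℝ, Model (d + 1)) 𝓘(ℝ, ℝ) (f ∘ e) (c.symm z)
          (mfderiv 𝓘(ℝ, Model (d + 1)) 𝓘(ℝ, Model (d + 1)) c.symm z v) : ℝ) := fun z hz v => by
      rw [← mfderiv_eq_fderiv]
      exact mfderiv_comp_apply z (g := f ∘ e)
        ((hfe.contMDiffAt (e.open_source.mem_nhds hz.2.1)).mdifferentiableAt (by simp))
        (hmc z hz) v
    have hH : DifferentiableAt ℝ (chartForm gN.inner b) (b (e (c.symm (c p))).2) :=
      ((contDiffOn_chartForm gN.contMDiff hbm).contDiffAt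
        (b.open_target.mem_nhds (b.map_source hpΩ.2.2.2))).differentiableAt (by simp)
    have hform : ∀ z ∈ Ω, ∀ v w : Model (d + 1), chartForm g.val c z v w =
        -(fderiv ℝ (fun z => (e (c.symm z)).1) z v * fderiv ℝ (fun z => (e (c.symm z)).1) z w) +
        f (e (c.symm z)) ^ 2 * chartForm gN.inner b (b (e (c.symm z)).2)
          (fderiv ℝ (fun z => b (e (c.symm z)).2) z v)
          (fderiv ℝ (fun z => b (e (c.symm z)).2) z w) := fun z hz v w => by
      rw [hdτ z hz, hdτ z hz, hdx z hz, hdx z hz, chartForm_mfderiv gN.inner hbm hz.2.2.2]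
      exact hg (c.symm z) hz.2.1 _ _
    have hτX : ∀ z ∈ Ω, fderiv ℝ (fun z => (e (c.symm z)).1) z (chartField u c z) = 1 :=
      fun z hz => by
      rw [hdτ z hz, mfderiv_symm_chartField hc u hz.1]
      exact mfderiv_fst_timeField hes hesymm hz.2.1
    have hxX : ∀ z ∈ Ω, fderiv ℝ (fun z => b (e (c.symm z)).2) z (chartField u c z) = 0 :=
      fun z hz => by
      rw [hdx z hz, mfderiv_symm_chartField hc u hz.1]
      exact (congrArg (mfderiv 𝓘(ℝ, Model d) 𝓘(ℝ, Model d) b (e (c.symm z)).2)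
        (mfderiv_snd_timeField hes hesymm hz.2.1)).trans (map_zero _)
    have hXd : DifferentiableAt ℝ (chartField u c) (c p) :=
      (hX.contDiffAt hnhds).differentiableAt (by simp)
    have hmain := covDifferential_of_twisted (G := chartForm g.val c) (X := chartField u c)
      (y := c p) (H := chartForm gN.inner b) (x := fun z => b (e (c.symm z)).2)
      (f := fun z => f (e (c.symm z))) (τ := fun z => (e (c.symm z)).1)
      (((contDiffOn_chartMetric g hc).contDiffAt (c.open_target.mem_nhds hpΩ.1)).differentiableAt
        (by simp)) hXd (hτ.contDiffAt hnhds) (hx.contDiffAt hnhds)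
      ((hfc.contDiffAt hnhds).differentiableAt (by simp))
      (hf0 _ (e.map_source hpΩ.2.1)).ne' hH
      (Filter.Eventually.of_forall fun z v w => chartMetric_symm g c z v w)
      (Filter.mem_of_superset hnhds hform) (Filter.mem_of_superset hnhds hτX)
      (Filter.mem_of_superset hnhds hxX)
    rw [covDeriv_eq_covDifferential g hc u hpΩ.1 hXd, hmain, lowerComp_eq g hc u hpΩ.1,
      lowerComp_eq g hc u hpΩ.1, metricComp_eq, hdf _ hpΩ, mfderiv_symm_chartField hc u hpΩ.1,
      c.left_inv hpc]
    rfl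

end FromTwisted

end TwistedLorentz

end

theorem mainTheorem1 (d : ℕ) (M : Type u) [TopologicalSpace M]
    [ChartedSpace (TwistedLorentz.Model (d + 1)) M]
    [IsManifold 𝓘(ℝ, TwistedLorentz.Model (d + 1)) ∞ M]
    (g : TwistedLorentz.LorentzMetric d M) :
    (∀ p : M,
      (∃ U : Set M, IsOpen U ∧ p ∈ U ∧ TwistedLorentz.IsTwistedProductOn.{0, u} g U) ↔
      (∃ U : Set M, IsOpen U ∧ p ∈ U ∧
        ∃ u, TwistedLorentz.IsTorseFormingUnitTimelikeOn g u U)) ∧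
    ((∃ u, TwistedLorentz.IsTorseFormingUnitTimelikeOn g u univ) →
      ∀ p : M, ∃ U : Set M, IsOpen U ∧ p ∈ U ∧
        TwistedLorentz.IsTwistedProductOn.{0, u} g U) ∧
    (TwistedLorentz.IsTwistedProductOn.{w, u} g univ →
      ∃ u, TwistedLorentz.IsTorseFormingUnitTimelikeOn g u univ) := by
  refine ⟨fun p => ⟨?_, ?_⟩, ?_, fun h => h.exists_isTorseFormingUnitTimelikeOn⟩
  · rintro ⟨U, hU, hp, h⟩
    exact ⟨U, hU, hp, h.exists_isTorseFormingUnitTimelikeOn⟩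
  · rintro ⟨U, hU, hp, u, hu⟩
    exact hu.exists_isTwistedProductOn hU hp
  · rintro ⟨u, hu⟩ p
    exact hu.exists_isTwistedProductOn isOpen_univ (mem_univ p)
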